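/- Fix the standard numbering $\varphi_0,\varphi_1,\dots$ of the partial computable functions on $\mathbb{N}$, let $K=\{n\in\mathbb{N} : \varphi_n(n)\text{ converges}\}$ be the halting set, and let $p_0<p_1<p_2<\cdots$ be the sequence of all primes. For a group $A$, its index set $I(A)$ is the set of all $e$ such that $\varphi_e$ is the characteristic function of the atomic diagram (the set of G\"odel numbers of the true atomic and negated atomic sentences in the signature $\{\cdot,{}^{-1},1\}$ with constants for the elements) of some group $B\cong A$ whose universe is a subset of $\mathbb{N}$. For a subgroup $G$ of the additive group $\mathbb{Q}$ with $1\in G$, write $G\models m\mid 1$ if there is $g\in G$ with $m\cdot g=1$, and put $$P^{\infty}(G)=\{p\text{ prime} : G\models p^k\mid 1\text{ for all }k\},\qquad P^{\mathrm{fin}}(G)=\{p\text{ prime} : G\models p\mid 1\text{ and } G\not\models p^k\mid 1\text{ for some }k\}.$$ **Proposition.** Let $G\subseteq\mathbb{Q}$ be a subgroup such that $1\in G$, $P^{\infty}(G)=\{p_n : n\in K\}$ and $P^{\mathrm{fin}}(G)=\emptyset$. Then $I(G)$ is $m$-complete $\Sigma_3$; that is, $I(G)$ is a $\Sigma_3$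 set of natural numbers, and every $\Sigma_3$ set of natural numbers is many-one reducible to $I(G)$. -/

import Mathlib

namespace IndexSets

/-- The standard numbering `φ_0, φ_1, …` of the partial computable functions `ℕ ⇀ ℕ`. -/
def phi (e : ℕ) : ℕ →. ℕ :=
  Nat.Partrec.Code.eval (Denumerable.ofNat Nat.Partrec.Code e)

/-- The halting set `K = {n | φ_n(n)↓}`. -/
def haltingSet : Set ℕ := {n | (phi n n).Dom}

/-- `φ_e` is total and is the characteristic function of `D`. -/
def IsCharIndex (e : ℕ) (D : Set ℕ) : Prop :=
  ∀ m : ℕ, (m ∈ D → 1 ∈ phi e m) ∧ (m ∉ D → 0 ∈ phi e m)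

/-! ### Atomic diagrams in the signature `{·, ⁻¹, 1}` -/

/-- Closed terms in the signature `{·, ⁻¹, 1}` together with a constant for each element
of `C`. -/
inductive GroupTerm (C : Type) : Type
  | one : GroupTerm C
  | const : C → GroupTerm C
  | inv : GroupTerm C → GroupTerm C
  | mul : GroupTerm C → GroupTerm C → GroupTerm C

/-- The value of a closed term, where the constant for `c` denotes `c`. -/
def GroupTerm.eval {C : Type} [Group C] : GroupTerm C → C
  | .one => 1
  | .const c => c
  | .inv t => t.eval⁻¹
  | .mul s t => s.eval * t.eval

/-- Gödel numbers of closed terms whose constants are natural numbers. -/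
def GroupTerm.code {U : Set ℕ} : GroupTerm U → ℕ
  | .one => 0
  | .const c => 3 * (c : ℕ) + 1
  | .inv t => 3 * t.code + 2
  | .mul s t => 3 * Nat.pair s.code t.code + 3

theorem GroupTerm.code_injective {U : Set ℕ} :
    Function.Injective (GroupTerm.code : GroupTerm U → ℕ) := by
  intro s
  induction s with
  | one => intro t h; cases t <;> simp only [GroupTerm.code] at h <;> first | rfl | omega
  | const c =>
    intro t h
    cases t <;> simp only [GroupTerm.code] at h <;> try omega
    congr 1
    exact Subtype.ext (by omega)
  | inv s ih =>
    intro t h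
    cases t <;> simp only [GroupTerm.code] at h <;> try omega
    congr 1
    exact ih (by omega)
  | mul s₁ s₂ ih₁ ih₂ =>
    intro t h
    cases t <;> simp only [GroupTerm.code] at h <;> try omega
    rename_i t₁ t₂
    have h' : Nat.pair s₁.code s₂.code = Nat.pair t₁.code t₂.code := by omega
    obtain ⟨h₁, h₂⟩ := Nat.pair_eq_pair.1 h'
    rw [ih₁ h₁, ih₂ h₂]

/-- The atomic diagram of a group whose universe is a set `U` of natural numbers: the set of
Gödel numbers of the true sentences `s = t` (with number `2⟨s, t⟩`) and `s ≠ t` (with number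
`2⟨s, t⟩ + 1`), for closed terms `s`, `t` with constants from `U`. -/
def atomicDiagram (U : Set ℕ) [Group U] : Set ℕ :=
  {m | ∃ s t : GroupTerm U,
    (s.eval = t.eval ∧ m = 2 * Nat.pair s.code t.code) ∨
    (s.eval ≠ t.eval ∧ m = 2 * Nat.pair s.code t.code + 1)}

/-- The index set `I(A)`: all `e` such that `φ_e` is the characteristic function of the atomic
diagram of a group, with universe a set of natural numbers, that is isomorphic to `A`. -/
def indexSet (A : Type*) [Group A] : Set ℕ :=
  {e | ∃ (U : Set ℕ) (_ : Group U), Nonempty (U ≃* A) ∧ IsCharIndex e (atomicDiagram U)}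

/-! ### The class `Σ₃` and completeness -/

/-- `S` is `Σ₃`: it has the form `{n | ∃ x ∀ y ∃ z R(n, x, y, z)}` with `R` computable. -/
def IsSigma3 (S : Set ℕ) : Prop :=
  ∃ R : ℕ × ℕ × ℕ × ℕ → Prop, ComputablePred R ∧
    ∀ n, n ∈ S ↔ ∃ x, ∀ y, ∃ z, R (n, x, y, z)

/-- `S` is `m`-complete for the class `Γ`: it lies in `Γ`, and every set in `Γ` is many-one
reducible to it. -/
def IsMComplete (Γ : Set ℕ → Prop) (S : Set ℕ) : Prop :=
  Γ S ∧ ∀ T : Set ℕ, Γ T → ManyOneReducible (fun n => n ∈ T) (fun n => n ∈ S)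

/-! ### Divisibility invariants of subgroups of `ℚ` -/

/-- `G ⊨ m ∣ 1`: the number `1` is an `m`-th multiple of an element of `G`. -/
def DividesOne (G : AddSubgroup ℚ) (m : ℕ) : Prop :=
  ∃ g ∈ G, m • g = (1 : ℚ)

/-- `P^fin(G)`: the primes `p` with `p ∣ 1` in `G` and `p ^ k ∤ 1` in `G` for some `k`. -/
def PFin (G : AddSubgroup ℚ) : Set ℕ :=
  {p | p.Prime ∧ DividesOne G p ∧ ∃ k : ℕ, ¬ DividesOne G (p ^ k)}

/-- `P^∞(G)`: the primes `p` with `p ^ k ∣ 1` in `G` for all `k`. -/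
def PInf (G : AddSubgroup ℚ) : Set ℕ :=
  {p | p.Prime ∧ ∀ k : ℕ, DividesOne G (p ^ k)}

end IndexSets

/-! Since no prime divides 1 in `G` only finitely often, `G` consists of the fractions whose
denominators are products of primes `p_k` with `k ∈ K`. Enumerating `K` in stages makes `G` the
union of a computable increasing chain of cyclic groups, `G = fracGroup (infDen K)`, by
`eq_fracGroup_infDen`.

Upper bound. Once a constant `b` is chosen to denote 1, the value `(k - l) / d` of a term is
expressed by the atomic sentence `a ^ d * b ^ l = b ^ k`. That `φ_e` decides the diagram of a copy
of `G` in which `b` is 1 then becomes a list of universally quantified r.e. conditions (`Presents`),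
so it is `Π₂`. The quantifier over `b` makes the index set `Σ₃`.

Lower bound. By Baer's theorem, enlarging `G` by adjoining `1/p` for a set of primes `p` not
dividing 1 in `G` gives a group isomorphic to `G` exactly when that set is finite
(`nonempty_addEquiv_of_finite`, `finite_of_addEquiv`). For a `Σ₃` statement `∃ x ∀ y ∃ z R(n, x, y,
z)`, a marker for each `x` moves from `j` to `j + 1` when some `x' ≤ x` has witnesses for all `y < j
+ 1`. Each position `i = ⟨x, j⟩` owns a prime `p_{F⟨n, i⟩}`, where the injective function `F` is
chosen so that `F⟨n, i⟩ ∈ K` exactly if the marker moves on from `i`. When the marker reaches `i`,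
the inverse of this prime is adjoined. If the marker later leaves, `G` contained that inverse
anyway; only final resting places contribute new primes. If `x` is a true witness, all markers from
`x` on move forever and finitely many primes are new; if there is no witness, every marker comes to
rest and infinitely many are new (`finite_marker_iff`). -/

namespace IndexSets

/-! ### Closure properties of computable functions and of computable and r.e. predicates -/

attribute [fun_prop] Computable ComputablePred REPred

section Closure

variable {α β γ σ : Type*} [Primcodable α] [Primcodable β] [Primcodable γ] [Primcodable σ]

@[fun_prop] theorem computable_id : Computable (fun a : α => a) := Computable.id

attribute [fun_prop] Computable.const

@[fun_prop] theorem computable_comp {f : β → σ} {g : α → β} (hf : Computable f)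
    (hg : Computable g) : Computable (fun a => f (g a)) := hf.comp hg

@[fun_prop] theorem computable_pair {f : α → β} {g : α → γ} (hf : Computable f)
    (hg : Computable g) : Computable (fun a => (f a, g a)) := hf.pair hg

@[fun_prop] theorem computable_fst {f : α → β × γ} (hf : Computable f) :
    Computable (fun a => (f a).1) := Computable.fst.comp hf

@[fun_prop] theorem computable_snd {f : α → β × γ} (hf : Computable f) :
    Computable (fun a => (f a).2) := Computable.snd.comp hf

@[fun_prop] theorem computable_add {f g : α → ℕ} (hf : Computable f) (hg : Computable g) :
    Computable (fun a => f a + g a) := Primrec.nat_add.to_comp.comp hf hg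

@[fun_prop] theorem computable_mul {f g : α → ℕ} (hf : Computable f) (hg : Computable g) :
    Computable (fun a => f a * g a) := Primrec.nat_mul.to_comp.comp hf hg

@[fun_prop] theorem computable_sub {f g : α → ℕ} (hf : Computable f) (hg : Computable g) :
    Computable (fun a => f a - g a) := Primrec.nat_sub.to_comp.comp hf hg

@[fun_prop] theorem computable_div {f g : α → ℕ} (hf : Computable f) (hg : Computable g) :
    Computable (fun a => f a / g a) := Primrec.nat_div.to_comp.comp hf hg

@[fun_prop] theorem computable_mod {f g : α → ℕ} (hf : Computable f) (hg : Computable g) :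
    Computable (fun a => f a % g a) := Primrec.nat_mod.to_comp.comp hf hg

@[fun_prop] theorem computable_natPair {f g : α → ℕ} (hf : Computable f) (hg : Computable g) :
    Computable (fun a => Nat.pair (f a) (g a)) := Primrec₂.natPair.to_comp.comp hf hg

@[fun_prop] theorem computable_unpair {f : α → ℕ} (hf : Computable f) :
    Computable (fun a => Nat.unpair (f a)) := Computable.unpair.comp hf

@[fun_prop] theorem computable_ofNat_code {f : α → ℕ} (hf : Computable f) :
    Computable (fun a => Denumerable.ofNat Nat.Partrec.Code (f a)) :=
  (Computable.ofNat Nat.Partrec.Code).comp hf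

@[fun_prop] theorem computable_isSome {f : α → Option β} (hf : Computable f) :
    Computable (fun a => (f a).isSome) := Primrec.option_isSome.to_comp.comp hf

@[fun_prop] theorem computable_evaln {k n : α → ℕ} {c : α → Nat.Partrec.Code} (hk : Computable k)
    (hc : Computable c) (hn : Computable n) :
    Computable (fun a => Nat.Partrec.Code.evaln (k a) (c a) (n a)) :=
  Nat.Partrec.Code.primrec_evaln.to_comp.comp ((hk.pair hc).pair hn)

theorem computable_rec {f : α → ℕ} {g : α → σ} {h : α → ℕ → σ → σ} (hf : Computable f)
    (hg : Computable g) (hh : Computable fun p : α × ℕ × σ => h p.1 p.2.1 p.2.2) :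
    Computable fun a => Nat.rec (motive := fun _ => σ) (g a) (h a) (f a) :=
  Computable.nat_rec hf hg (h := fun a p => h a p.1 p.2) hh

@[fun_prop] theorem computable_pow {f g : α → ℕ} (hf : Computable f) (hg : Computable g) :
    Computable (fun a => f a ^ g a) :=
  (computable_rec hg (Computable.const 1) (h := fun a _ r => r * f a) (by fun_prop)).of_eq
    fun a => by induction g a with
      | zero => rfl
      | succ n ih => rw [pow_succ, ← ih]

theorem computable_prod {f : α → ℕ} {g : α → ℕ → ℕ} (hf : Computable f)
    (hg : Computable fun p : α × ℕ => g p.1 p.2) :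
    Computable fun a => ∏ i ∈ Finset.range (f a), g a i :=
  (computable_rec hf (Computable.const 1) (h := fun a i r => r * g a i) (by fun_prop)).of_eq
    fun a => by induction f a with
      | zero => rfl
      | succ n ih => rw [Finset.prod_range_succ, ← ih]

@[fun_prop] theorem computablePred_comp {p : β → Prop} {g : α → β} (hp : ComputablePred p)
    (hg : Computable g) : ComputablePred (fun a => p (g a)) := by
  classical exact Computable.computablePred (hp.decide.comp hg)

@[fun_prop] theorem computablePred_not {p : α → Prop} (hp : ComputablePred p) :
    ComputablePred (fun a => ¬ p a) := hp.not

@[fun_prop] theorem computablePred_and {p q : α → Prop} (hp : ComputablePred p)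
    (hq : ComputablePred q) : ComputablePred (fun a => p a ∧ q a) := by
  classical
  exact Computable.computablePred
    ((Primrec.and.to_comp.comp hp.decide hq.decide).of_eq fun a => by simp)

@[fun_prop] theorem computablePred_or {p q : α → Prop} (hp : ComputablePred p)
    (hq : ComputablePred q) : ComputablePred (fun a => p a ∨ q a) := by
  classical
  exact Computable.computablePred
    ((Primrec.or.to_comp.comp hp.decide hq.decide).of_eq fun a => by simp)

@[fun_prop] theorem computablePred_eq {f g : α → β} (hf : Computable f) (hg : Computable g) :
    ComputablePred (fun a => f a = g a) := by
  classical
  exact Computable.computablePred (Primrec.eq.decide.to_comp.comp hf hg)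

@[fun_prop] theorem computablePred_le {f g : α → ℕ} (hf : Computable f) (hg : Computable g) :
    ComputablePred (fun a => f a ≤ g a) :=
  Computable.computablePred (Primrec.nat_le.decide.to_comp.comp hf hg)

theorem computable_ite {c : α → Prop} [DecidablePred c] {f g : α → β} (hc : ComputablePred c)
    (hf : Computable f) (hg : Computable g) : Computable fun a => if c a then f a else g a :=
  (Computable.cond hc.decide hf hg).of_eq fun a => by by_cases h : c a <;> simp [h]

open Classical in
theorem computablePred_forall_lt {f : α → ℕ} {p : α → ℕ → Prop} (hf : Computable f)
    (hp : ComputablePred fun x : α × ℕ => p x.1 x.2) :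
    ComputablePred fun a => ∀ i < f a, p a i := by
  have h := computable_prod hf (g := fun a i => if p a i then 1 else 0)
    (computable_ite hp (Computable.const 1) (Computable.const 0))
  refine (computablePred_not (computablePred_eq h (Computable.const 0))).of_eq fun a => ?_
  simp [Finset.prod_eq_zero_iff]

theorem computablePred_exists_lt {f : α → ℕ} {p : α → ℕ → Prop} (hf : Computable f)
    (hp : ComputablePred fun x : α × ℕ => p x.1 x.2) :
    ComputablePred fun a => ∃ i < f a, p a i := by
  refine (computablePred_forall_lt hf (p := fun a i => ¬ p a i) hp.not).not.of_eq fun a => ?_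
  simp

theorem rePred_exists_of_computablePred {q : α → ℕ → Prop}
    (hq : ComputablePred fun x : α × ℕ => q x.1 x.2) : REPred fun a => ∃ s, q a s := by
  classical
  have : Partrec fun a => Nat.rfind ((fun s => decide (q a s) : ℕ → Bool) : ℕ →. Bool) :=
    Partrec.rfind hq.decide.partrec
  refine this.dom_re.of_eq fun a => ⟨fun h => ?_, fun ⟨s, hs⟩ => ?_⟩
  · obtain ⟨s, hs, -⟩ := Nat.rfind_dom.1 h
    exact ⟨s, by simpa using hs⟩
  · exact Nat.rfind_dom.2 ⟨s, by simpa using hs, fun _ => trivial⟩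

/-- A predicate is r.e. iff it is the union of a computable increasing sequence of predicates. -/
theorem rePred_iff {p : α → Prop} :
    REPred p ↔ ∃ q : α → ℕ → Prop, (ComputablePred fun x : α × ℕ => q x.1 x.2) ∧
      (∀ a s t, s ≤ t → q a s → q a t) ∧ ∀ a, p a ↔ ∃ s, q a s := by
  constructor
  · intro hp
    obtain ⟨c, hc⟩ := Nat.Partrec.Code.exists_code.1 hp
    refine ⟨fun a s => ((Nat.Partrec.Code.evaln s c (Encodable.encode a)).isSome = true), ?_,
      fun a s t hst h => ?_, fun a => ?_⟩
    · have : Computable fun a : α => Encodable.encode a := Computable.encode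
      fun_prop
    · obtain ⟨x, hx⟩ := Option.isSome_iff_exists.1 h
      exact Option.isSome_iff_exists.2 ⟨x, Nat.Partrec.Code.evaln_mono hst hx⟩
    · have h1 : p a ↔ (c.eval (Encodable.encode a)).Dom := by
        rw [hc]
        simp [Part.assert]
      rw [h1, Part.dom_iff_mem]
      simp only [Nat.Partrec.Code.evaln_complete, Option.isSome_iff_exists]
      exact exists_comm
  · rintro ⟨q, hq, -, h⟩
    exact (rePred_exists_of_computablePred hq).of_eq fun a => (h a).symm

@[fun_prop] theorem rePred_comp {p : β → Prop} {g : α → β} (hp : REPred p) (hg : Computable g) :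
    REPred (fun a => p (g a)) := Partrec.comp hp hg

theorem rePred_exists_nat {p : α → ℕ → Prop} (hp : REPred fun x : α × ℕ => p x.1 x.2) :
    REPred fun a => ∃ n, p a n := by
  obtain ⟨q, hq, -, h⟩ := rePred_iff.1 hp
  have h' : ComputablePred fun x : α × ℕ => q (x.1, x.2.unpair.1) x.2.unpair.2 := by fun_prop
  refine (rePred_exists_of_computablePred (q := fun a s => q (a, s.unpair.1) s.unpair.2) h').of_eq fun a => ?_
  constructor
  · rintro ⟨s, hs⟩
    exact ⟨_, (h (a, s.unpair.1)).2 ⟨_, hs⟩⟩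
  · rintro ⟨n, hn⟩
    obtain ⟨s, hs⟩ := (h (a, n)).1 hn
    exact ⟨Nat.pair n s, by simpa using hs⟩

@[fun_prop] theorem rePred_and {p q : α → Prop} (hp : REPred p) (hq : REPred q) :
    REPred (fun a => p a ∧ q a) := by
  obtain ⟨p', hp', mp, ep⟩ := rePred_iff.1 hp
  obtain ⟨q', hq', mq, eq⟩ := rePred_iff.1 hq
  refine rePred_iff.2 ⟨fun a s => p' a s ∧ q' a s, by fun_prop,
    fun a s t hst h => ⟨mp _ _ _ hst h.1, mq _ _ _ hst h.2⟩, fun a => ?_⟩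
  rw [ep, eq]
  constructor
  · rintro ⟨⟨s, hs⟩, t, ht⟩
    exact ⟨max s t, mp _ _ _ (le_max_left _ _) hs, mq _ _ _ (le_max_right _ _) ht⟩
  · rintro ⟨s, hs, ht⟩
    exact ⟨⟨s, hs⟩, s, ht⟩

@[fun_prop] theorem rePred_or {p q : α → Prop} (hp : REPred p) (hq : REPred q) :
    REPred (fun a => p a ∨ q a) := by
  obtain ⟨p', hp', mp, ep⟩ := rePred_iff.1 hp
  obtain ⟨q', hq', mq, eq⟩ := rePred_iff.1 hq
  refine rePred_iff.2 ⟨fun a s => p' a s ∨ q' a s, by fun_prop,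
    fun a s t hst h => h.imp (mp _ _ _ hst) (mq _ _ _ hst), fun a => ?_⟩
  rw [ep, eq, ← exists_or]

end Closure

/-! ### Presentations of subgroups of `ℚ` -/

/-- The value in `ℚ` of a closed term, where the constant for `c` denotes `f c`. -/
def ratEval {U : Set ℕ} (f : U → ℚ) : GroupTerm U → ℚ
  | .one => 0
  | .const c => f c
  | .inv t => -ratEval f t
  | .mul s t => ratEval f s + ratEval f t

/-- The atomic diagram obtained by interpreting constants in `ℚ` through `f`. -/
def ratDiagram {U : Set ℕ} (f : U → ℚ) : Set ℕ :=
  {m | ∃ s t : GroupTerm U,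
    (ratEval f s = ratEval f t ∧ m = 2 * Nat.pair s.code t.code) ∨
    (ratEval f s ≠ ratEval f t ∧ m = 2 * Nat.pair s.code t.code + 1)}

section Diagram

variable {U : Set ℕ} {f : U → ℚ}

theorem two_mul_pair_mem_ratDiagram {a b : ℕ} :
    2 * Nat.pair a b ∈ ratDiagram f ↔
      ∃ s t : GroupTerm U, s.code = a ∧ t.code = b ∧ ratEval f s = ratEval f t := by
  constructor
  · rintro ⟨s, t, ⟨h, e⟩ | ⟨-, e⟩⟩
    · obtain ⟨h1, h2⟩ := Nat.pair_eq_pair.1 (by omega : Nat.pair a b = Nat.pair s.code t.code)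
      exact ⟨s, t, h1.symm, h2.symm, h⟩
    · omega
  · rintro ⟨s, t, rfl, rfl, h⟩
    exact ⟨s, t, Or.inl ⟨h, rfl⟩⟩

theorem two_mul_pair_add_one_mem_ratDiagram {a b : ℕ} :
    2 * Nat.pair a b + 1 ∈ ratDiagram f ↔
      ∃ s t : GroupTerm U, s.code = a ∧ t.code = b ∧ ratEval f s ≠ ratEval f t := by
  constructor
  · rintro ⟨s, t, ⟨h, e⟩ | ⟨h, e⟩⟩
    · omega
    · obtain ⟨h1, h2⟩ := Nat.pair_eq_pair.1 (by omega : Nat.pair a b = Nat.pair s.code t.code)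
      exact ⟨s, t, h1.symm, h2.symm, h⟩
  · rintro ⟨s, t, rfl, rfl, h⟩
    exact ⟨s, t, Or.inr ⟨h, rfl⟩⟩

theorem two_mul_pair_code_mem_ratDiagram {s t : GroupTerm U} :
    2 * Nat.pair s.code t.code ∈ ratDiagram f ↔ ratEval f s = ratEval f t := by
  rw [two_mul_pair_mem_ratDiagram]
  constructor
  · rintro ⟨s', t', hs, ht, h⟩
    rwa [GroupTerm.code_injective hs, GroupTerm.code_injective ht] at h
  · exact fun h => ⟨s, t, rfl, rfl, h⟩

/-- The sentence `a = a` serves throughout as the test for being the code of a term over the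
universe. -/
theorem two_mul_pair_self_mem_ratDiagram {a : ℕ} :
    2 * Nat.pair a a ∈ ratDiagram f ↔ a ∈ Set.range (GroupTerm.code : GroupTerm U → ℕ) := by
  rw [two_mul_pair_mem_ratDiagram]
  constructor
  · rintro ⟨s, -, h, -⟩
    exact ⟨s, h⟩
  · rintro ⟨s, h⟩
    exact ⟨s, s, h, h, rfl⟩

theorem const_mem_range_code {c : ℕ} :
    3 * c + 1 ∈ Set.range (GroupTerm.code : GroupTerm U → ℕ) ↔ c ∈ U := by
  constructor
  · rintro ⟨t, ht⟩
    cases t with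
    | const c' =>
      simp only [GroupTerm.code] at ht
      have : (c' : ℕ) = c := by omega
      exact this ▸ c'.2
    | _ => simp only [GroupTerm.code] at ht; omega
  · exact fun h => ⟨.const ⟨c, h⟩, rfl⟩

theorem inv_mem_range_code {a : ℕ} :
    3 * a + 2 ∈ Set.range (GroupTerm.code : GroupTerm U → ℕ) ↔
      a ∈ Set.range (GroupTerm.code : GroupTerm U → ℕ) := by
  constructor
  · rintro ⟨t, ht⟩
    cases t with
    | inv t =>
      simp only [GroupTerm.code] at ht
      exact ⟨t, by omega⟩
    | _ => simp only [GroupTerm.code] at ht; omega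
  · rintro ⟨t, rfl⟩
    exact ⟨.inv t, rfl⟩

theorem mul_mem_range_code {a b : ℕ} :
    3 * Nat.pair a b + 3 ∈ Set.range (GroupTerm.code : GroupTerm U → ℕ) ↔
      a ∈ Set.range (GroupTerm.code : GroupTerm U → ℕ) ∧
      b ∈ Set.range (GroupTerm.code : GroupTerm U → ℕ) := by
  constructor
  · rintro ⟨t, ht⟩
    cases t with
    | mul s t =>
      simp only [GroupTerm.code] at ht
      obtain ⟨h1, h2⟩ := Nat.pair_eq_pair.1 (by omega : Nat.pair s.code t.code = Nat.pair a b)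
      exact ⟨⟨s, h1⟩, t, h2⟩
    | _ => simp only [GroupTerm.code] at ht; omega
  · rintro ⟨⟨s, rfl⟩, t, rfl⟩
    exact ⟨.mul s t, rfl⟩

end Diagram

theorem IsCharIndex.mem_iff {e : ℕ} {D : Set ℕ} (h : IsCharIndex e D) {m : ℕ} :
    m ∈ D ↔ 1 ∈ phi e m := by
  refine ⟨(h m).1, fun h1 => ?_⟩
  by_contra hm
  exact absurd (Part.mem_unique h1 ((h m).2 hm)) one_ne_zero

theorem IsCharIndex.notMem_iff {e : ℕ} {D : Set ℕ} (h : IsCharIndex e D) {m : ℕ} :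
    m ∉ D ↔ 0 ∈ phi e m := by
  refine ⟨(h m).2, fun h0 hm => ?_⟩
  exact absurd (Part.mem_unique h0 ((h m).1 hm)) zero_ne_one

theorem IsCharIndex.unique {e : ℕ} {D D' : Set ℕ} (h : IsCharIndex e D) (h' : IsCharIndex e D') :
    D = D' :=
  Set.ext fun _ => h.mem_iff.trans h'.mem_iff.symm

theorem atomicDiagram_eq_ratDiagram {U : Set ℕ} [Group U] {f : U → ℚ} (hf : Function.Injective f)
    (h : ∀ t : GroupTerm U, f t.eval = ratEval f t) : atomicDiagram U = ratDiagram f := by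
  ext m
  simp only [atomicDiagram, ratDiagram, Set.mem_ofPred_eq, ← h, hf.eq_iff, ne_eq]

/-- Removes abstract groups from the problem: an isomorphism onto `H` is remembered only as an
injection into `ℚ`, and conversely the group structure on `U` is pulled back along the injection. -/
theorem mem_indexSet_iff {H : AddSubgroup ℚ} {e : ℕ} :
    e ∈ indexSet (Multiplicative H) ↔ ∃ (U : Set ℕ) (f : U → ℚ),
      Function.Injective f ∧ Set.range f = H ∧ IsCharIndex e (ratDiagram f) := by
  constructor
  · rintro ⟨U, _, ⟨θ⟩, h⟩
    have hinj : Function.Injective fun u : U => ((θ u).toAdd : ℚ) :=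
      fun u v huv => θ.injective (Multiplicative.toAdd.injective (Subtype.ext huv))
    refine ⟨U, fun u => (θ u).toAdd, hinj, ?_, ?_⟩
    · ext q
      constructor
      · rintro ⟨u, rfl⟩
        exact (θ u).toAdd.2
      · intro hq
        exact ⟨θ.symm (Multiplicative.ofAdd ⟨q, hq⟩), by simp⟩
    · rwa [← atomicDiagram_eq_ratDiagram hinj]
      intro t
      induction t with
      | one => simp [GroupTerm.eval, ratEval]
      | const c => rfl
      | inv t ih => simp [GroupTerm.eval, ratEval, ← ih]
      | mul s t ihs iht => simp [GroupTerm.eval, ratEval, ← ihs, ← iht]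
  · rintro ⟨U, f, hf, hr, h⟩
    let E : U ≃ Multiplicative H :=
      ((Equiv.ofInjective f hf).trans (Equiv.setCongr hr)).trans Multiplicative.ofAdd
    have hE : ∀ u, ((E u).toAdd : ℚ) = f u := fun u => rfl
    let _ : Group U := E.group
    let θ : U ≃* Multiplicative H := E.mulEquiv
    have hθ : ∀ u, ((θ u).toAdd : ℚ) = f u := hE
    refine ⟨U, inferInstance, ⟨θ⟩, ?_⟩
    rwa [atomicDiagram_eq_ratDiagram hf]
    intro t
    induction t with
    | one => simp [GroupTerm.eval, ratEval, ← hθ]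
    | const c => rfl
    | inv t ih => rw [ratEval, ← ih, ← hθ, ← hθ]; simp [GroupTerm.eval]
    | mul s t ihs iht => rw [ratEval, ← ihs, ← iht, ← hθ, ← hθ, ← hθ]; simp [GroupTerm.eval]

/-- A diagram determines the presented group up to isomorphism. -/
theorem addEquiv_of_ratDiagram_eq {H H' : AddSubgroup ℚ} {U U' : Set ℕ} {f : U → ℚ} {f' : U' → ℚ}
    (hf : Function.Injective f) (hf' : Function.Injective f') (hr : Set.range f = H)
    (hr' : Set.range f' = H') (h : ratDiagram f = ratDiagram f') : Nonempty (H ≃+ H') := by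
  -- The universe is read off the diagram as the set of `c` for which `c = c` is a sentence in it.
  obtain rfl : U = U' := Set.ext fun c => by
    rw [← const_mem_range_code, ← two_mul_pair_self_mem_ratDiagram (f := f), h,
      two_mul_pair_self_mem_ratDiagram, const_mem_range_code]
  have key : ∀ s t : GroupTerm U, ratEval f s = ratEval f t ↔ ratEval f' s = ratEval f' t := by
    intro s t
    rw [← two_mul_pair_code_mem_ratDiagram, h, two_mul_pair_code_mem_ratDiagram]
  let E : U ≃ H := (Equiv.ofInjective f hf).trans (Equiv.setCongr hr)
  let E' : U ≃ H' := (Equiv.ofInjective f' hf').trans (Equiv.setCongr hr')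
  have hE : ∀ u, (E u : ℚ) = f u := fun u => rfl
  have hE' : ∀ u, (E' u : ℚ) = f' u := fun u => rfl
  refine ⟨{ E.symm.trans E' with map_add' := fun x y => ?_ }⟩
  obtain ⟨u, rfl⟩ := E.surjective x
  obtain ⟨v, rfl⟩ := E.surjective y
  -- The sentence `w = u * v` lies in the common diagram, so the second interpretation has the same
  -- addition table.
  obtain ⟨w, hw⟩ := E.surjective (E u + E v)
  have h1 : f w = f u + f v := by rw [← hE, hw, AddSubgroup.coe_add, hE, hE]
  have h2 := (key (.const w) (.mul (.const u) (.const v))).1 h1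
  apply Subtype.ext
  simp only [Equiv.toFun_as_coe, ← hw, Equiv.trans_apply, Equiv.symm_apply_apply,
    AddSubgroup.coe_add, hE']
  exact h2

theorem nonempty_addEquiv_of_mem_indexSet {H H' : AddSubgroup ℚ} {e : ℕ}
    (h : e ∈ indexSet (Multiplicative H)) (h' : e ∈ indexSet (Multiplicative H')) :
    Nonempty (H ≃+ H') := by
  obtain ⟨U, f, hf, hr, hc⟩ := mem_indexSet_iff.1 h
  obtain ⟨U', f', hf', hr', hc'⟩ := mem_indexSet_iff.1 h'
  exact addEquiv_of_ratDiagram_eq hf hf' hr hr' (hc.unique hc')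

theorem indexSet_congr {A B : Type*} [Group A] [Group B] (θ : A ≃* B) :
    indexSet A = indexSet B := by
  ext e
  exact ⟨fun ⟨U, i, ⟨ψ⟩, h⟩ => ⟨U, i, ⟨ψ.trans θ⟩, h⟩,
    fun ⟨U, i, ⟨ψ⟩, h⟩ => ⟨U, i, ⟨ψ.trans θ.symm⟩, h⟩⟩

/-! ### Groups of fractions -/

/-- The group of all rationals with a denominator in the divisibility chain `N`. -/
def fracGroup (N : ℕ → ℕ) (hN : ∀ s t, s ≤ t → N s ∣ N t) : AddSubgroup ℚ where
  carrier := {q | ∃ (s : ℕ) (k : ℤ), q * N s = k}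
  zero_mem' := ⟨0, 0, by simp⟩
  neg_mem' := by
    rintro q ⟨s, k, h⟩
    exact ⟨s, -k, by push_cast; rw [neg_mul, h]⟩
  add_mem' := by
    rintro q r ⟨s, k, h⟩ ⟨t, l, h'⟩
    obtain ⟨u, hu⟩ := hN s (max s t) (le_max_left _ _)
    obtain ⟨v, hv⟩ := hN t (max s t) (le_max_right _ _)
    refine ⟨max s t, k * u + l * v, ?_⟩
    rw [add_mul]
    nth_rw 1 [hu]
    rw [hv]
    push_cast
    rw [← h, ← h']
    ring

theorem mem_fracGroup {N : ℕ → ℕ} {hN : ∀ s t, s ≤ t → N s ∣ N t} {q : ℚ} :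
    q ∈ fracGroup N hN ↔ ∃ (s : ℕ) (k : ℤ), q * N s = k := Iff.rfl

/-- Numerators are written as differences of naturals, so that fractions are described by triples of
naturals and by powers with natural exponents. -/
theorem mem_fracGroup_iff_natSub {N : ℕ → ℕ} {hN : ∀ s t, s ≤ t → N s ∣ N t} (h0 : ∀ s, 0 < N s)
    {q : ℚ} : q ∈ fracGroup N hN ↔ ∃ s k l : ℕ, q = ((k : ℚ) - l) / N s := by
  have hne : ∀ s, (N s : ℚ) ≠ 0 := fun s => Nat.cast_ne_zero.2 (h0 s).ne'
  rw [mem_fracGroup]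
  constructor
  · rintro ⟨s, k, h⟩
    refine ⟨s, k.toNat, (-k).toNat, ?_⟩
    rw [eq_div_iff (hne s), h]
    exact_mod_cast (Int.toNat_sub_toNat_neg k).symm
  · rintro ⟨s, k, l, rfl⟩
    exact ⟨s, k - l, by rw [div_mul_cancel₀ _ (hne s)]; push_cast; rfl⟩

/-! ### Recognising presentations of a group of fractions -/

/-- The code of the `n`-th power of the term with code `a`. -/
def powCode (a n : ℕ) : ℕ := Nat.rec 0 (fun _ r => 3 * Nat.pair a r + 3) n

/-- The code of the sentence `a ^ d * b ^ l = b ^ k`, for a term code `a` and a constant `b`. -/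
def valCode (b a d k l : ℕ) : ℕ :=
  2 * Nat.pair (3 * Nat.pair (powCode a d) (powCode (3 * b + 1) l) + 3) (powCode (3 * b + 1) k)

section

variable {α : Type*} [Primcodable α]

@[fun_prop] theorem computable_powCode {f g : α → ℕ} (hf : Computable f) (hg : Computable g) :
    Computable fun a => powCode (f a) (g a) :=
  computable_rec hg (Computable.const 0) (h := fun a _ r => 3 * Nat.pair (f a) r + 3) (by fun_prop)

@[fun_prop] theorem computable_valCode {b a d k l : α → ℕ} (hb : Computable b) (ha : Computable a)
    (hd : Computable d) (hk : Computable k) (hl : Computable l) :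
    Computable fun x => valCode (b x) (a x) (d x) (k x) (l x) := by
  unfold valCode
  fun_prop

end

/-- The sentences in the extension of `tr` are the true ones and those in the extension of `fl`
the false ones of a presentation of the group of fractions of `N`, where the constant `b`
denotes `1`. -/
structure Presents (N : ℕ → ℕ) (b : ℕ) (tr fl : ℕ → Prop) : Prop where
  -- Every clause uses `tr` and `fl` only positively, failure of a sentence being expressed by `fl`.
  -- Its matrix is therefore r.e. as soon as `tr` and `fl` are.
  total : ∀ m, tr m ∨ fl m
  one_mem : tr (2 * Nat.pair 0 0)
  inv_mem : ∀ a, (tr (2 * Nat.pair (3 * a + 2) (3 * a + 2)) ∧ tr (2 * Nat.pair a a)) ∨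
    (fl (2 * Nat.pair (3 * a + 2) (3 * a + 2)) ∧ fl (2 * Nat.pair a a))
  mul_mem : ∀ a a',
    (tr (2 * Nat.pair (3 * Nat.pair a a' + 3) (3 * Nat.pair a a' + 3)) ∧
      tr (2 * Nat.pair a a) ∧ tr (2 * Nat.pair a' a')) ∨
    (fl (2 * Nat.pair (3 * Nat.pair a a' + 3) (3 * Nat.pair a a' + 3)) ∧
      (fl (2 * Nat.pair a a) ∨ fl (2 * Nat.pair a' a')))
  sentence : ∀ m, fl m ∨ (tr (2 * Nat.pair (m / 2).unpair.1 (m / 2).unpair.1) ∧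
    tr (2 * Nat.pair (m / 2).unpair.2 (m / 2).unpair.2))
  const_ne : ∀ c c', c = c' ∨ fl (2 * Nat.pair (3 * c + 1) (3 * c' + 1))
  exists_val : ∀ a, fl (2 * Nat.pair a a) ∨ ∃ s k l, tr (valCode b a (N s) k l)
  exists_const : ∀ s k l, ∃ c, tr (valCode b (3 * c + 1) (N s) k l)
  val_one : tr (valCode b 0 1 0 0)
  -- The values of two terms determine the values of product and inverse, and decide the equation
  -- between them. A zero exponent is excluded because `a ^ 0` says nothing about `a`.
  val : ∀ a d k l a' d' k' l',
    d = 0 ∨ d' = 0 ∨ fl (valCode b a d k l) ∨ fl (valCode b a' d' k' l') ∨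
    (tr (valCode b (3 * Nat.pair a a' + 3) (d * d') (k * d' + k' * d) (l * d' + l' * d)) ∧
      tr (valCode b (3 * a + 2) d l k) ∧
      ((k * d' + l' * d = k' * d + l * d' ∧
          tr (2 * Nat.pair a a') ∧ fl (2 * Nat.pair a a' + 1)) ∨
        (k * d' + l' * d ≠ k' * d + l * d' ∧
          fl (2 * Nat.pair a a') ∧ tr (2 * Nat.pair a a' + 1))))

/-- The `n`-th power of a term. -/
def powTerm {U : Set ℕ} (t : GroupTerm U) (n : ℕ) : GroupTerm U :=
  Nat.rec .one (fun _ r => .mul t r) n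

section

variable {U : Set ℕ} {f : U → ℚ}

theorem code_powTerm (t : GroupTerm U) (n : ℕ) : (powTerm t n).code = powCode t.code n := by
  induction n with
  | zero => rfl
  | succ n ih =>
    change 3 * Nat.pair t.code (powTerm t n).code + 3 = 3 * Nat.pair t.code (powCode t.code n) + 3
    rw [ih]

theorem ratEval_powTerm (t : GroupTerm U) (n : ℕ) :
    ratEval f (powTerm t n) = n * ratEval f t := by
  induction n with
  | zero => simp [powTerm, ratEval]
  | succ n ih =>
    change ratEval f t + ratEval f (powTerm t n) = _
    rw [ih]
    push_cast
    ring

/-- For `n = 0` this fails: the power is the code of the term `1`, whatever `a` is. -/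
theorem mem_range_code_of_powCode {a n : ℕ} (hn : n ≠ 0)
    (h : powCode a n ∈ Set.range (GroupTerm.code : GroupTerm U → ℕ)) :
    a ∈ Set.range (GroupTerm.code : GroupTerm U → ℕ) := by
  obtain ⟨n, rfl⟩ := Nat.exists_eq_succ_of_ne_zero hn
  exact (mul_mem_range_code.1 h).1

/-- With `b` read as 1, the sentence says `d * x + l = k` for the value `x` of the term. Since `d ≠
0`, its being a sentence already forces `a` to be a term code. -/
theorem valCode_mem_ratDiagram {b : U} (hb : f b = 1) {a d k l : ℕ} (hd : d ≠ 0) :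
    valCode b a d k l ∈ ratDiagram f ↔
      ∃ t : GroupTerm U, t.code = a ∧ ratEval f t = ((k : ℚ) - l) / d := by
  have hd' : (d : ℚ) ≠ 0 := Nat.cast_ne_zero.2 hd
  have hcode : ∀ t : GroupTerm U, valCode b t.code d k l =
      2 * Nat.pair (GroupTerm.mul (powTerm t d) (powTerm (.const b) l)).code
        (powTerm (.const b) k).code := by
    intro t
    simp only [valCode, GroupTerm.code, code_powTerm]
  have hval : ∀ t : GroupTerm U, valCode b t.code d k l ∈ ratDiagram f ↔
      ratEval f t = ((k : ℚ) - l) / d := by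
    intro t
    rw [hcode, two_mul_pair_code_mem_ratDiagram, eq_div_iff hd', ratEval, ratEval_powTerm,
      ratEval_powTerm, ratEval_powTerm, ratEval, hb, mul_one, mul_one, eq_sub_iff_add_eq, mul_comm]
  constructor
  · intro h
    obtain ⟨s, -, hs, -⟩ := two_mul_pair_mem_ratDiagram.1 h
    have h1 : 3 * Nat.pair (powCode a d) (powCode (3 * b + 1) l) + 3 ∈
      Set.range (GroupTerm.code : GroupTerm U → ℕ) := ⟨s, hs⟩
    obtain ⟨t, rfl⟩ := mem_range_code_of_powCode hd (mul_mem_range_code.1 h1).1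
    exact ⟨t, rfl, (hval t).1 h⟩
  · rintro ⟨t, rfl, h⟩
    exact (hval t).2 h

end

/-- Equality of fractions becomes a decidable identity in `ℕ`, with negative terms moved across to
avoid truncated subtraction. -/
theorem cross_mul_eq_iff {d d' k l k' l' : ℕ} (hd : d ≠ 0) (hd' : d' ≠ 0) :
    ((k : ℚ) - l) / d = ((k' : ℚ) - l') / d' ↔ k * d' + l' * d = k' * d + l * d' := by
  rw [div_eq_div_iff (Nat.cast_ne_zero.2 hd) (Nat.cast_ne_zero.2 hd'), ← Nat.cast_inj (R := ℚ)]
  push_cast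
  constructor <;> intro h <;> linarith

theorem presents_of_ratDiagram {N : ℕ → ℕ} {hN : ∀ s t, s ≤ t → N s ∣ N t} (h0 : ∀ s, 0 < N s)
    {U : Set ℕ} {f : U → ℚ} (hf : Function.Injective f) (hr : Set.range f = fracGroup N hN)
    {b : U} (hb : f b = 1) : Presents N b (· ∈ ratDiagram f) (· ∉ ratDiagram f) where
  total m := Classical.em _
  one_mem := two_mul_pair_self_mem_ratDiagram.2 ⟨.one, rfl⟩
  inv_mem a := by
    simp only [two_mul_pair_self_mem_ratDiagram, inv_mem_range_code]
    tauto
  mul_mem a a' := by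
    simp only [two_mul_pair_self_mem_ratDiagram, mul_mem_range_code]
    tauto
  sentence m := by
    rw [or_iff_not_imp_left, not_not]
    simp only [two_mul_pair_self_mem_ratDiagram]
    rintro ⟨s, t, ⟨-, rfl⟩ | ⟨-, rfl⟩⟩
    · rw [Nat.mul_div_cancel_left _ two_pos, Nat.unpair_pair]
      exact ⟨⟨s, rfl⟩, t, rfl⟩
    · rw [show (2 * Nat.pair s.code t.code + 1) / 2 = Nat.pair s.code t.code by omega,
        Nat.unpair_pair]
      exact ⟨⟨s, rfl⟩, t, rfl⟩
  const_ne c c' := by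
    rw [or_iff_not_imp_right, not_not]
    intro h
    obtain ⟨s, t, hs, ht, -⟩ := two_mul_pair_mem_ratDiagram.1 h
    have hc : c ∈ U := const_mem_range_code.1 ⟨s, hs⟩
    have hc' : c' ∈ U := const_mem_range_code.1 ⟨t, ht⟩
    have := (two_mul_pair_code_mem_ratDiagram (f := f) (s := .const ⟨c, hc⟩)
      (t := .const ⟨c', hc'⟩)).1 h
    exact congrArg Subtype.val (hf this)
  exists_val a := by
    rw [or_iff_not_imp_left, not_not, two_mul_pair_self_mem_ratDiagram]
    rintro ⟨t, rfl⟩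
    have hmem : ratEval f t ∈ fracGroup N hN := by
      have hc : ∀ u, f u ∈ fracGroup N hN := fun u => by
        rw [← SetLike.mem_coe, ← hr]
        exact ⟨u, rfl⟩
      induction t with
      | one => exact zero_mem _
      | const c => exact hc c
      | inv t ih => exact neg_mem ih
      | mul s t ihs iht => exact add_mem ihs iht
    obtain ⟨s, k, l, h⟩ := (mem_fracGroup_iff_natSub h0).1 hmem
    exact ⟨s, k, l, (valCode_mem_ratDiagram hb (h0 s).ne').2 ⟨t, rfl, h⟩⟩
  exists_const s k l := by
    have : ((k : ℚ) - l) / N s ∈ Set.range f := by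
      rw [hr]
      exact (mem_fracGroup_iff_natSub h0).2 ⟨s, k, l, rfl⟩
    obtain ⟨c, hc⟩ := this
    exact ⟨c, (valCode_mem_ratDiagram hb (h0 s).ne').2 ⟨.const c, rfl, hc⟩⟩
  val_one := (valCode_mem_ratDiagram hb one_ne_zero).2 ⟨.one, rfl, by simp [ratEval]⟩
  val a d k l a' d' k' l' := by
    by_cases hd : d = 0
    · exact Or.inl hd
    by_cases hd' : d' = 0
    · exact Or.inr (Or.inl hd')
    by_cases h : valCode b a d k l ∈ ratDiagram f
    swap
    · exact Or.inr (Or.inr (Or.inl h))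
    by_cases h' : valCode b a' d' k' l' ∈ ratDiagram f
    swap
    · exact Or.inr (Or.inr (Or.inr (Or.inl h')))
    have hq : (d : ℚ) ≠ 0 := Nat.cast_ne_zero.2 hd
    have hq' : (d' : ℚ) ≠ 0 := Nat.cast_ne_zero.2 hd'
    obtain ⟨t, rfl, ht⟩ := (valCode_mem_ratDiagram hb hd).1 h
    obtain ⟨t', rfl, ht'⟩ := (valCode_mem_ratDiagram hb hd').1 h'
    refine Or.inr (Or.inr (Or.inr (Or.inr ⟨?_, ?_, ?_⟩)))
    · refine (valCode_mem_ratDiagram hb (mul_ne_zero hd hd')).2 ⟨.mul t t', rfl, ?_⟩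
      rw [ratEval, ht, ht']
      push_cast
      field_simp
      ring
    · refine (valCode_mem_ratDiagram hb hd).2 ⟨.inv t, rfl, ?_⟩
      rw [ratEval, ht, ← neg_div, neg_sub]
    · rw [two_mul_pair_code_mem_ratDiagram, two_mul_pair_add_one_mem_ratDiagram, ht, ht',
        cross_mul_eq_iff hd hd']
      have h2 : (∃ s s' : GroupTerm U, s.code = t.code ∧ s'.code = t'.code ∧
          ratEval f s ≠ ratEval f s') ↔ k * d' + l' * d ≠ k' * d + l * d' := by
        rw [ne_eq, ← cross_mul_eq_iff hd hd', ← ht, ← ht']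
        constructor
        · rintro ⟨s, s', hs, hs', hne⟩
          rwa [GroupTerm.code_injective hs, GroupTerm.code_injective hs'] at hne
        · exact fun hne => ⟨t, t', rfl, rfl, hne⟩
      rw [h2]
      tauto

/-- The clauses suffice to rebuild the group: each constant receives the fraction given by
`exists_val`, the clause `val` propagates these fractions through all terms, and the same clause
makes truth of a sentence agree with truth in `ℚ`. -/
theorem exists_ratDiagram_of_presents {N : ℕ → ℕ} {hN : ∀ s t, s ≤ t → N s ∣ N t}
    (h0 : ∀ s, 0 < N s) {b : ℕ} {tr fl : ℕ → Prop} (hp : Presents N b tr fl)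
    (hex : ∀ m, tr m → ¬ fl m) :
    ∃ (U : Set ℕ) (f : U → ℚ), Function.Injective f ∧ Set.range f = fracGroup N hN ∧
      ∀ m, m ∈ ratDiagram f ↔ tr m := by
  let U : Set ℕ := {c | tr (2 * Nat.pair (3 * c + 1) (3 * c + 1))}
  have hinv : ∀ a, tr (2 * Nat.pair (3 * a + 2) (3 * a + 2)) ↔ tr (2 * Nat.pair a a) := by
    intro a
    have := hp.inv_mem a
    have := hex (2 * Nat.pair (3 * a + 2) (3 * a + 2))
    have := hex (2 * Nat.pair a a)
    tauto
  have hmul : ∀ a a', tr (2 * Nat.pair (3 * Nat.pair a a' + 3) (3 * Nat.pair a a' + 3)) ↔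
      tr (2 * Nat.pair a a) ∧ tr (2 * Nat.pair a' a') := by
    intro a a'
    have := hp.mul_mem a a'
    have := hex (2 * Nat.pair (3 * Nat.pair a a' + 3) (3 * Nat.pair a a' + 3))
    have := hex (2 * Nat.pair a a)
    have := hex (2 * Nat.pair a' a')
    tauto
  have hsent : ∀ a a' i, i < 2 → tr (2 * Nat.pair a a' + i) →
      tr (2 * Nat.pair a a) ∧ tr (2 * Nat.pair a' a') := by
    intro a a' i hi h
    have := (hp.sentence _).resolve_left (hex _ h)
    rwa [show (2 * Nat.pair a a' + i) / 2 = Nat.pair a a' by omega, Nat.unpair_pair] at this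
  -- Each natural number has exactly one of the four shapes of a code, and the subterm codes are
  -- smaller, so strong induction applies.
  have hW : ∀ a, tr (2 * Nat.pair a a) ↔ a ∈ Set.range (GroupTerm.code : GroupTerm U → ℕ) := by
    intro a
    induction a using Nat.strong_induction_on with
    | _ a ih =>
      obtain h | ⟨c, h | h | h⟩ :
          a = 0 ∨ ∃ c, a = 3 * c + 1 ∨ a = 3 * c + 2 ∨ a = 3 * c + 3 := by
        rcases Nat.eq_zero_or_pos a with h | h
        · exact Or.inl h
        · exact Or.inr ⟨(a - 1) / 3, by omega⟩
      · subst h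
        exact ⟨fun _ => ⟨.one, rfl⟩, fun _ => hp.one_mem⟩
      · subst h
        rw [const_mem_range_code]
        rfl
      · subst h
        rw [inv_mem_range_code, hinv, ih c (by omega)]
      · subst h
        have h1 := Nat.unpair_left_le c
        have h2 := Nat.unpair_right_le c
        rw [← Nat.pair_unpair c, mul_mem_range_code, hmul, ih _ (by omega), ih _ (by omega)]
  -- Only a relation for now: that a term has at most one value follows from `hval` with `a = a'`.
  let val (a : ℕ) (q : ℚ) : Prop :=
    ∃ d k l, d ≠ 0 ∧ tr (valCode b a d k l) ∧ q = ((k : ℚ) - l) / d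
  have hval : ∀ a a' q q', val a q → val a' q' →
      val (3 * Nat.pair a a' + 3) (q + q') ∧ val (3 * a + 2) (-q) ∧
      (tr (2 * Nat.pair a a') ↔ q = q') ∧ (tr (2 * Nat.pair a a' + 1) ↔ q ≠ q') := by
    rintro a a' q q' ⟨d, k, l, hd, h, rfl⟩ ⟨d', k', l', hd', h', rfl⟩
    obtain ⟨h1, h2, h3⟩ := (((hp.val a d k l a' d' k' l').resolve_left hd).resolve_left
      hd').resolve_left (hex _ h) |>.resolve_left (hex _ h')
    have hq : (d : ℚ) ≠ 0 := Nat.cast_ne_zero.2 hd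
    have hq' : (d' : ℚ) ≠ 0 := Nat.cast_ne_zero.2 hd'
    refine ⟨⟨_, _, _, mul_ne_zero hd hd', h1, ?_⟩, ⟨_, _, _, hd, h2, ?_⟩, ?_⟩
    · push_cast
      field_simp
      ring
    · rw [← neg_div, neg_sub]
    · rw [ne_eq, cross_mul_eq_iff hd hd']
      have := hex (2 * Nat.pair a a')
      have := hex (2 * Nat.pair a a' + 1)
      tauto
  have hf : ∀ c : U, ∃ q, val (3 * c + 1) q ∧ q ∈ fracGroup N hN := by
    intro c
    obtain ⟨s, k, l, h⟩ := (hp.exists_val (3 * c + 1)).resolve_left (hex _ c.2)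
    exact ⟨_, ⟨_, _, _, (h0 s).ne', h, rfl⟩, (mem_fracGroup_iff_natSub h0).2 ⟨s, k, l, rfl⟩⟩
  choose f hf hfG using hf
  have heval : ∀ t : GroupTerm U, val t.code (ratEval f t) := by
    intro t
    induction t with
    | one => exact ⟨1, 0, 0, one_ne_zero, hp.val_one, by simp [ratEval]⟩
    | const c => exact hf c
    | inv t ih => exact (hval _ _ _ _ ih ih).2.1
    | mul s t ihs iht => exact (hval _ _ _ _ ihs iht).1
  refine ⟨U, f, fun c c' h => ?_, Set.Subset.antisymm ?_ ?_, fun m => ?_⟩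
  · refine Subtype.ext ((hp.const_ne c c').resolve_right (hex _ ?_))
    exact (hval _ _ _ _ (hf c) (hf c')).2.2.1.2 h
  · rintro _ ⟨c, rfl⟩
    exact hfG c
  · intro q hq
    obtain ⟨s, k, l, rfl⟩ := (mem_fracGroup_iff_natSub h0).1 hq
    obtain ⟨c, hc⟩ := hp.exists_const s k l
    have h1 := (hW _).1 ((hmul _ _).1 (hsent _ _ 0 two_pos hc).1).1
    have hcU : tr (2 * Nat.pair (3 * c + 1) (3 * c + 1)) :=
      (hW _).2 (mem_range_code_of_powCode (h0 s).ne' h1)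
    -- Two values of `c`, the chosen one and the prescribed fraction, coincide because `c = c` is
    -- true.
    exact ⟨⟨c, hcU⟩, (hval _ _ _ _ (hf ⟨c, hcU⟩) ⟨_, _, _, (h0 s).ne', hc, rfl⟩).2.2.1.1 hcU⟩
  · constructor
    · rintro ⟨s, t, ⟨h, rfl⟩ | ⟨h, rfl⟩⟩
      · exact (hval _ _ _ _ (heval s) (heval t)).2.2.1.2 h
      · exact (hval _ _ _ _ (heval s) (heval t)).2.2.2.2 h
    · intro h
      have hm : m = 2 * Nat.pair (m / 2).unpair.1 (m / 2).unpair.2 + m % 2 := by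
        rw [Nat.pair_unpair]
        omega
      rw [hm] at h
      obtain ⟨h1, h2⟩ := hsent _ _ _ (Nat.mod_lt _ two_pos) h
      obtain ⟨s, hs⟩ := (hW _).1 h1
      obtain ⟨t, ht⟩ := (hW _).1 h2
      rw [← hs, ← ht] at h hm
      refine ⟨s, t, ?_⟩
      obtain h2 | h2 := Nat.mod_two_eq_zero_or_one m
      · rw [h2] at h hm
        exact Or.inl ⟨(hval _ _ _ _ (heval s) (heval t)).2.2.1.1 h, hm⟩
      · rw [h2] at h hm
        exact Or.inr ⟨(hval _ _ _ _ (heval s) (heval t)).2.2.2.1 h, hm⟩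

/-! ### The upper bound -/

/-- `p` is a universal quantification of an r.e. predicate. -/
def IsPi2 {α : Type*} [Primcodable α] (p : α → Prop) : Prop :=
  ∃ q : α → ℕ → Prop, (REPred fun x : α × ℕ => q x.1 x.2) ∧ ∀ a, p a ↔ ∀ y, q a y

section

variable {α : Type*} [Primcodable α]

theorem IsPi2.of_rePred {p : α → Prop} (hp : REPred p) : IsPi2 p :=
  ⟨fun a _ => p a, by fun_prop, fun a => by simp⟩

theorem IsPi2.and {p q : α → Prop} (hp : IsPi2 p) (hq : IsPi2 q) :
    IsPi2 fun a => p a ∧ q a := by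
  obtain ⟨p', hp', h⟩ := hp
  obtain ⟨q', hq', h'⟩ := hq
  refine ⟨fun a y => p' a y ∧ q' a y, by fun_prop, fun a => ?_⟩
  exact (and_congr (h a) (h' a)).trans forall_and.symm

theorem IsPi2.forall_nat {p : α → ℕ → Prop} (hp : IsPi2 fun x : α × ℕ => p x.1 x.2) :
    IsPi2 fun a => ∀ n, p a n := by
  obtain ⟨p', hp', h⟩ := hp
  refine ⟨fun a y => p' (a, y.unpair.1) y.unpair.2, ?_, fun a => ?_⟩
  · have : REPred fun x : (α × ℕ) × ℕ => p' (x.1.1, x.1.2) x.2 := hp'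
    fun_prop
  · constructor
    · exact fun H y => (h (a, y.unpair.1)).1 (H _) _
    · intro H n
      refine (h (a, n)).2 fun y => ?_
      simpa using H (Nat.pair n y)

end

theorem isSigma3_of_isPi2 {S : Set ℕ} {p : ℕ → ℕ → Prop} (hp : IsPi2 fun x : ℕ × ℕ => p x.1 x.2)
    (h : ∀ n, n ∈ S ↔ ∃ x, p n x) : IsSigma3 S := by
  obtain ⟨q, hq, hpq⟩ := hp
  obtain ⟨r, hr, -, hqr⟩ := rePred_iff.1 hq
  refine ⟨fun x => r ((x.1, x.2.1), x.2.2.1) x.2.2.2, by fun_prop, fun n => ?_⟩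
  rw [h]
  refine exists_congr fun x => (hpq (n, x)).trans (forall_congr' fun y => hqr ((n, x), y))

theorem rePred_mem_phi (v : ℕ) : REPred fun x : ℕ × ℕ => v ∈ phi x.1 x.2 := by
  have : ComputablePred fun x : (ℕ × ℕ) × ℕ =>
      Nat.Partrec.Code.evaln x.2 (Denumerable.ofNat Nat.Partrec.Code x.1.1) x.1.2 = some v := by
    fun_prop
  refine (rePred_exists_of_computablePred (q := fun x s => Nat.Partrec.Code.evaln s
    (Denumerable.ofNat Nat.Partrec.Code x.1) x.2 = some v) this).of_eq fun x => ?_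
  exact Nat.Partrec.Code.evaln_complete.symm

theorem isPi2_presents {N : ℕ → ℕ} (hN : Computable N) {tr fl : ℕ → ℕ → Prop}
    (htr : REPred fun x : ℕ × ℕ => tr x.1 x.2) (hfl : REPred fun x : ℕ × ℕ => fl x.1 x.2) :
    IsPi2 fun x : ℕ × ℕ => Presents N x.2 (tr x.1) (fl x.1) := by
  have eqv : ∀ {α : Type} [Primcodable α] {f g : α → ℕ}, Computable f → Computable g →
      REPred fun a => f a = g a := fun hf hg => (computablePred_eq hf hg).to_re
  have nev : ∀ {α : Type} [Primcodable α] {f g : α → ℕ}, Computable f → Computable g →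
      REPred fun a => f a ≠ g a := fun hf hg => (computablePred_eq hf hg).not.to_re
  have h1 : IsPi2 fun x : ℕ × ℕ => ∀ m, tr x.1 m ∨ fl x.1 m :=
    .forall_nat <| .of_rePred <| by fun_prop
  have h2 : IsPi2 fun x : ℕ × ℕ => tr x.1 (2 * Nat.pair 0 0) := .of_rePred <| by fun_prop
  have h3 : IsPi2 fun x : ℕ × ℕ => ∀ a,
      (tr x.1 (2 * Nat.pair (3 * a + 2) (3 * a + 2)) ∧ tr x.1 (2 * Nat.pair a a)) ∨
      (fl x.1 (2 * Nat.pair (3 * a + 2) (3 * a + 2)) ∧ fl x.1 (2 * Nat.pair a a)) :=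
    .forall_nat <| .of_rePred <| by fun_prop
  have h4 : IsPi2 fun x : ℕ × ℕ => ∀ a a',
      (tr x.1 (2 * Nat.pair (3 * Nat.pair a a' + 3) (3 * Nat.pair a a' + 3)) ∧
        tr x.1 (2 * Nat.pair a a) ∧ tr x.1 (2 * Nat.pair a' a')) ∨
      (fl x.1 (2 * Nat.pair (3 * Nat.pair a a' + 3) (3 * Nat.pair a a' + 3)) ∧
        (fl x.1 (2 * Nat.pair a a) ∨ fl x.1 (2 * Nat.pair a' a'))) :=
    .forall_nat <| .forall_nat <| .of_rePred <| by fun_prop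
  have h5 : IsPi2 fun x : ℕ × ℕ => ∀ m,
      fl x.1 m ∨ (tr x.1 (2 * Nat.pair (m / 2).unpair.1 (m / 2).unpair.1) ∧
        tr x.1 (2 * Nat.pair (m / 2).unpair.2 (m / 2).unpair.2)) :=
    .forall_nat <| .of_rePred <| by fun_prop
  have h6 : IsPi2 fun x : ℕ × ℕ => ∀ c c',
      c = c' ∨ fl x.1 (2 * Nat.pair (3 * c + 1) (3 * c' + 1)) :=
    .forall_nat <| .forall_nat <| .of_rePred <|
      rePred_or (eqv (by fun_prop) (by fun_prop)) (by fun_prop)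
  have h7 : IsPi2 fun x : ℕ × ℕ => ∀ a,
      fl x.1 (2 * Nat.pair a a) ∨ ∃ s k l, tr x.1 (valCode x.2 a (N s) k l) :=
    .forall_nat <| .of_rePred <| rePred_or (by fun_prop) <|
      rePred_exists_nat <| rePred_exists_nat <| rePred_exists_nat <| by fun_prop
  have h8 : IsPi2 fun x : ℕ × ℕ => ∀ s k l, ∃ c, tr x.1 (valCode x.2 (3 * c + 1) (N s) k l) :=
    .forall_nat <| .forall_nat <| .forall_nat <| .of_rePred <| rePred_exists_nat <| by fun_prop
  have h9 : IsPi2 fun x : ℕ × ℕ => tr x.1 (valCode x.2 0 1 0 0) := .of_rePred <| by fun_prop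
  have h10 : IsPi2 fun x : ℕ × ℕ => ∀ a d k l a' d' k' l',
      d = 0 ∨ d' = 0 ∨ fl x.1 (valCode x.2 a d k l) ∨ fl x.1 (valCode x.2 a' d' k' l') ∨
      (tr x.1 (valCode x.2 (3 * Nat.pair a a' + 3) (d * d') (k * d' + k' * d) (l * d' + l' * d)) ∧
        tr x.1 (valCode x.2 (3 * a + 2) d l k) ∧
        ((k * d' + l' * d = k' * d + l * d' ∧
            tr x.1 (2 * Nat.pair a a') ∧ fl x.1 (2 * Nat.pair a a' + 1)) ∨
          (k * d' + l' * d ≠ k' * d + l * d' ∧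
            fl x.1 (2 * Nat.pair a a') ∧ tr x.1 (2 * Nat.pair a a' + 1)))) :=
    .forall_nat <| .forall_nat <| .forall_nat <| .forall_nat <| .forall_nat <| .forall_nat <|
      .forall_nat <| .forall_nat <| .of_rePred <|
      rePred_or (eqv (by fun_prop) (by fun_prop)) <| rePred_or (eqv (by fun_prop) (by fun_prop)) <|
      rePred_or (by fun_prop) <| rePred_or (by fun_prop) <| rePred_and (by fun_prop) <|
      rePred_and (by fun_prop) <|
      rePred_or (rePred_and (eqv (by fun_prop) (by fun_prop)) (by fun_prop))
        (rePred_and (nev (by fun_prop) (by fun_prop)) (by fun_prop))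
  obtain ⟨q, hq, h⟩ := h1.and <| h2.and <| h3.and <| h4.and <| h5.and <| h6.and <| h7.and <|
    h8.and <| h9.and h10
  refine ⟨q, hq, fun a => Iff.trans ⟨?_, ?_⟩ (h a)⟩
  · rintro ⟨k1, k2, k3, k4, k5, k6, k7, k8, k9, k10⟩
    exact ⟨k1, k2, k3, k4, k5, k6, k7, k8, k9, k10⟩
  · rintro ⟨k1, k2, k3, k4, k5, k6, k7, k8, k9, k10⟩
    exact ⟨k1, k2, k3, k4, k5, k6, k7, k8, k9, k10⟩

/-- The leading existential quantifier guesses the constant denoting 1; the rest is `Presents`, with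
`tr` and `fl` the outputs 1 and 0 of `φ_e`. -/
theorem isSigma3_indexSet_fracGroup {N : ℕ → ℕ} (hN : ∀ s t, s ≤ t → N s ∣ N t)
    (h0 : ∀ s, 0 < N s) (hc : Computable N) :
    IsSigma3 (indexSet (Multiplicative (fracGroup N hN))) := by
  refine isSigma3_of_isPi2 (p := fun e b => Presents N b (1 ∈ phi e ·) (0 ∈ phi e ·))
    (isPi2_presents hc (tr := fun e m => 1 ∈ phi e m) (fl := fun e m => 0 ∈ phi e m)
      (rePred_mem_phi 1) (rePred_mem_phi 0)) fun e => ?_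
  rw [mem_indexSet_iff]
  constructor
  · rintro ⟨U, f, hf, hr, h⟩
    have h1 : (1 : ℚ) ∈ Set.range f := by
      rw [hr]
      exact ⟨0, N 0, by simp⟩
    obtain ⟨b, hb⟩ := h1
    have := presents_of_ratDiagram h0 hf hr hb
    refine ⟨b, ?_⟩
    convert this using 2 with m m
    · rw [← h.mem_iff]
    · rw [← h.notMem_iff]
  · rintro ⟨b, hb⟩
    obtain ⟨U, f, hf, hr, h⟩ := exists_ratDiagram_of_presents (hN := hN) h0 hb
      fun m h1 h2 => one_ne_zero (Part.mem_unique h1 h2)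
    refine ⟨U, f, hf, hr, fun m => ⟨(h m).1, fun hm => (hb.total m).resolve_left ?_⟩⟩
    rwa [← h]

/-! ### Uniform presentations of groups of fractions -/

/-- One step in the evaluation of the term with code `m`: `v` is the value of the constant, and
`x`, `y`, `z` are the values of the subterms. A triple `(k, l, d)` stands for `(k - l) / d`, and
for an undefined value if `d = 0`. -/
def stepVal (m : ℕ) (v x y z : ℕ × ℕ × ℕ) : ℕ × ℕ × ℕ :=
  if m = 0 then (0, 0, 1) else if m % 3 = 1 then v else if m % 3 = 2 then (x.2.1, x.1, x.2.2)
  else (y.1 * z.2.2 + z.1 * y.2.2, y.2.1 * z.2.2 + z.2.1 * y.2.2, y.2.2 * z.2.2)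

/-- The value of the term with code `m`, where `base` gives the values of the constants. -/
def termVal (base : ℕ → ℕ × ℕ × ℕ) (m : ℕ) : ℕ × ℕ × ℕ :=
  if _ : m = 0 then stepVal 0 0 0 0 0 else
  stepVal m (base ((m - 1) / 3)) (termVal base ((m - 1) / 3))
    (termVal base ((m - 1) / 3).unpair.1) (termVal base ((m - 1) / 3).unpair.2)
termination_by m
decreasing_by
  all_goals
    have h1 := Nat.unpair_left_le ((m - 1) / 3)
    have h2 := Nat.unpair_right_le ((m - 1) / 3)
    omega

theorem termVal_zero (base : ℕ → ℕ × ℕ × ℕ) : termVal base 0 = (0, 0, 1) := by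
  rw [termVal]
  rfl

theorem termVal_of_ne_zero (base : ℕ → ℕ × ℕ × ℕ) {m : ℕ} (hm : m ≠ 0) :
    termVal base m = stepVal m (base ((m - 1) / 3)) (termVal base ((m - 1) / 3))
      (termVal base ((m - 1) / 3).unpair.1) (termVal base ((m - 1) / 3).unpair.2) := by
  rw [termVal, dif_neg hm]

theorem termVal_const (base : ℕ → ℕ × ℕ × ℕ) (c : ℕ) : termVal base (3 * c + 1) = base c := by
  rw [termVal_of_ne_zero _ (by omega), stepVal, if_neg (by omega), if_pos (by omega)]
  congr 1
  omega

theorem termVal_inv (base : ℕ → ℕ × ℕ × ℕ) (a : ℕ) : termVal base (3 * a + 2) =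
    ((termVal base a).2.1, (termVal base a).1, (termVal base a).2.2) := by
  rw [termVal_of_ne_zero _ (by omega), stepVal, if_neg (by omega), if_neg (by omega),
    if_pos (by omega), show (3 * a + 2 - 1) / 3 = a by omega]

theorem termVal_mul (base : ℕ → ℕ × ℕ × ℕ) (a b : ℕ) : termVal base (3 * Nat.pair a b + 3) =
    ((termVal base a).1 * (termVal base b).2.2 + (termVal base b).1 * (termVal base a).2.2,
      (termVal base a).2.1 * (termVal base b).2.2 + (termVal base b).2.1 * (termVal base a).2.2,
      (termVal base a).2.2 * (termVal base b).2.2) := by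
  rw [termVal_of_ne_zero _ (by omega), stepVal, if_neg (by omega), if_neg (by omega),
    if_neg (by omega), show (3 * Nat.pair a b + 3 - 1) / 3 = Nat.pair a b by omega,
    Nat.unpair_pair]

section

variable {α β : Type*} [Primcodable α] [Primcodable β]

@[fun_prop] theorem computable_stepVal {m : α → ℕ} {v x y z : α → ℕ × ℕ × ℕ}
    (hm : Computable m) (hv : Computable v) (hx : Computable x) (hy : Computable y)
    (hz : Computable z) : Computable fun a => stepVal (m a) (v a) (x a) (y a) (z a) := by
  unfold stepVal
  exact computable_ite (by fun_prop) (by fun_prop) <| computable_ite (by fun_prop) (by fun_prop) <|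
    computable_ite (by fun_prop) (by fun_prop) (by fun_prop)

@[fun_prop] theorem computable_list_getD {L : α → List β} {i : α → ℕ} {d : α → β}
    (hL : Computable L) (hi : Computable i) (hd : Computable d) :
    Computable fun a => ((L a)[i a]?).getD (d a) :=
  Computable.option_getD (Computable.list_getElem?.comp hL hi) hd

@[fun_prop] theorem computable_list_length {L : α → List β} (hL : Computable L) :
    Computable fun a => (L a).length := Computable.list_length.comp hL

theorem computable_termVal {base : α → ℕ → ℕ × ℕ × ℕ}
    (hb : Computable fun x : α × ℕ => base x.1 x.2) :
    Computable fun x : α × ℕ => termVal (base x.1) x.2 := by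
  -- Course-of-values recursion: `L` lists the values at all smaller codes, so its length is the
  -- current code. The default 0 is reached only for code 0, where `stepVal` ignores it.
  refine Computable.nat_strong_rec (fun a m => termVal (base a) m)
    (g := fun a L => some (stepVal L.length (base a ((L.length - 1) / 3))
      (L[(L.length - 1) / 3]?.getD 0) (L[((L.length - 1) / 3).unpair.1]?.getD 0)
      (L[((L.length - 1) / 3).unpair.2]?.getD 0))) ?_ fun a m => ?_
  · refine Computable.option_some.comp ?_
    fun_prop
  · simp only [List.length_map, List.length_range]
    rcases Nat.eq_zero_or_pos m with rfl | hm
    · rw [termVal_zero]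
      rfl
    · have h1 := Nat.unpair_left_le ((m - 1) / 3)
      have h2 := Nat.unpair_right_le ((m - 1) / 3)
      have hget : ∀ i < m, ((List.range m).map (termVal (base a)))[i]?.getD 0 =
          termVal (base a) i := by
        intro i hi
        simp [hi]
      rw [hget _ (by omega), hget _ (by omega), hget _ (by omega), termVal_of_ne_zero _ hm.ne']

end

/-- Two natural numbers, read as pairs `(k, l, s)`, denote the same fraction `(k - l) / N s`. -/
def SameFrac (N : ℕ → ℕ) (c c' : ℕ) : Prop :=
  c.unpair.1 * N c'.unpair.2.unpair.2 + c'.unpair.2.unpair.1 * N c.unpair.2.unpair.2 =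
    c'.unpair.1 * N c.unpair.2.unpair.2 + c.unpair.2.unpair.1 * N c'.unpair.2.unpair.2

/-- The least codes of fractions. -/
def fracUniverse (N : ℕ → ℕ) : Set ℕ := {c | ∀ c' < c, ¬ SameFrac N c' c}

/-- The fraction denoted by a code. -/
def fracVal (N : ℕ → ℕ) (c : ℕ) : ℚ :=
  ((c.unpair.1 : ℚ) - c.unpair.2.unpair.1) / N c.unpair.2.unpair.2

open Classical in
/-- The value of a constant as a triple, undefined outside `fracUniverse N`. -/
noncomputable def fracBase (N : ℕ → ℕ) (c : ℕ) : ℕ × ℕ × ℕ :=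
  (c.unpair.1, c.unpair.2.unpair.1, if c ∈ fracUniverse N then N c.unpair.2.unpair.2 else 0)

/-- The set of numbers of true sentences, in terms of `termVal`. -/
def fracTrue (N : ℕ → ℕ) (m : ℕ) : Prop :=
  (termVal (fracBase N) (m / 2).unpair.1).2.2 ≠ 0 ∧
  (termVal (fracBase N) (m / 2).unpair.2).2.2 ≠ 0 ∧
  ((termVal (fracBase N) (m / 2).unpair.1).1 * (termVal (fracBase N) (m / 2).unpair.2).2.2 +
    (termVal (fracBase N) (m / 2).unpair.2).2.1 * (termVal (fracBase N) (m / 2).unpair.1).2.2 =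
    (termVal (fracBase N) (m / 2).unpair.2).1 * (termVal (fracBase N) (m / 2).unpair.1).2.2 +
    (termVal (fracBase N) (m / 2).unpair.1).2.1 * (termVal (fracBase N) (m / 2).unpair.2).2.2 ↔
    m % 2 = 0)

/-! ### Correctness of the evaluation of terms in a group of fractions -/

section

variable {N : ℕ → ℕ}

theorem sameFrac_iff (h0 : ∀ s, 0 < N s) {c c' : ℕ} :
    SameFrac N c c' ↔ fracVal N c = fracVal N c' :=
  (cross_mul_eq_iff (h0 _).ne' (h0 _).ne').symm

/-- Of two codes of one fraction the larger is not least, so it is not in the universe. -/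
theorem fracVal_injective (h0 : ∀ s, 0 < N s) :
    Function.Injective fun c : fracUniverse N => fracVal N c := by
  intro c c' h
  apply Subtype.ext
  rcases lt_trichotomy (c : ℕ) c' with hlt | heq | hlt
  · exact absurd ((sameFrac_iff h0).2 h) (c'.2 _ hlt)
  · exact heq
  · exact absurd ((sameFrac_iff h0).2 h.symm) (c.2 _ hlt)

theorem range_fracVal (h0 : ∀ s, 0 < N s) (hN : ∀ s t, s ≤ t → N s ∣ N t) :
    Set.range (fun c : fracUniverse N => fracVal N c) = fracGroup N hN := by
  ext q
  rw [SetLike.mem_coe, mem_fracGroup_iff_natSub h0]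
  constructor
  · rintro ⟨c, rfl⟩
    exact ⟨_, _, _, rfl⟩
  · rintro ⟨s, k, l, rfl⟩
    have hex : ∃ c, fracVal N c = ((k : ℚ) - l) / N s :=
      ⟨Nat.pair k (Nat.pair l s), by simp [fracVal]⟩
    classical
    refine ⟨⟨Nat.find hex, fun c' hc' h => Nat.find_min hex hc' ?_⟩, Nat.find_spec hex⟩
    rw [(sameFrac_iff h0).1 h, Nat.find_spec hex]

theorem termVal_code (h0 : ∀ s, 0 < N s) (t : GroupTerm (fracUniverse N)) :
    (termVal (fracBase N) t.code).2.2 ≠ 0 ∧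
    ratEval (fun c : fracUniverse N => fracVal N c) t =
      (((termVal (fracBase N) t.code).1 : ℚ) - (termVal (fracBase N) t.code).2.1) /
        (termVal (fracBase N) t.code).2.2 := by
  induction t with
  | one => simp [GroupTerm.code, termVal_zero, ratEval]
  | const c =>
    rw [GroupTerm.code, termVal_const, fracBase, if_pos c.2]
    exact ⟨(h0 _).ne', rfl⟩
  | inv t ih =>
    rw [GroupTerm.code, termVal_inv]
    refine ⟨ih.1, ?_⟩
    rw [ratEval, ih.2, ← neg_div, neg_sub]
  | mul s t ihs iht =>
    rw [GroupTerm.code, termVal_mul]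
    refine ⟨mul_ne_zero ihs.1 iht.1, ?_⟩
    have h1 : ((termVal (fracBase N) s.code).2.2 : ℚ) ≠ 0 := Nat.cast_ne_zero.2 ihs.1
    have h2 : ((termVal (fracBase N) t.code).2.2 : ℚ) ≠ 0 := Nat.cast_ne_zero.2 iht.1
    rw [ratEval, ihs.2, iht.2]
    push_cast
    field_simp
    ring

/-- A constant outside the universe has denominator 0, inverses keep denominators and products
multiply them, so one bad constant makes the whole denominator 0. -/
theorem mem_range_code_of_termVal {a : ℕ} (h : (termVal (fracBase N) a).2.2 ≠ 0) :
    a ∈ Set.range (GroupTerm.code : GroupTerm (fracUniverse N) → ℕ) := by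
  induction a using Nat.strong_induction_on with
  | _ a ih =>
    obtain rfl | ⟨c, rfl | rfl | rfl⟩ :
        a = 0 ∨ ∃ c, a = 3 * c + 1 ∨ a = 3 * c + 2 ∨ a = 3 * c + 3 := by
      rcases Nat.eq_zero_or_pos a with h | h
      · exact Or.inl h
      · exact Or.inr ⟨(a - 1) / 3, by omega⟩
    · exact ⟨.one, rfl⟩
    · rw [const_mem_range_code]
      rw [termVal_const, fracBase] at h
      by_contra hc
      exact h (if_neg hc)
    · rw [inv_mem_range_code]
      rw [termVal_inv] at h
      exact ih c (by omega) h
    · have h1 := Nat.unpair_left_le c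
      have h2 := Nat.unpair_right_le c
      rw [← Nat.pair_unpair c, termVal_mul] at h
      rw [← Nat.pair_unpair c, mul_mem_range_code]
      exact ⟨ih _ (by omega) (left_ne_zero_of_mul h), ih _ (by omega) (right_ne_zero_of_mul h)⟩

theorem fracTrue_iff (h0 : ∀ s, 0 < N s) {m : ℕ} :
    fracTrue N m ↔ m ∈ ratDiagram fun c : fracUniverse N => fracVal N c := by
  have key : ∀ s t : GroupTerm (fracUniverse N), ∀ i < 2,
      (fracTrue N (2 * Nat.pair s.code t.code + i) ↔
        (ratEval (fun c : fracUniverse N => fracVal N c) s =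
          ratEval (fun c : fracUniverse N => fracVal N c) t ↔ i = 0)) := by
    intro s t i hi
    rw [fracTrue, show (2 * Nat.pair s.code t.code + i) / 2 = Nat.pair s.code t.code by omega,
      show (2 * Nat.pair s.code t.code + i) % 2 = i by omega, Nat.unpair_pair,
      (termVal_code h0 s).2, (termVal_code h0 t).2,
      cross_mul_eq_iff (termVal_code h0 s).1 (termVal_code h0 t).1]
    exact ⟨fun h => h.2.2, fun h => ⟨(termVal_code h0 s).1, (termVal_code h0 t).1, h⟩⟩
  constructor
  · intro h
    obtain ⟨s, hs⟩ := mem_range_code_of_termVal h.1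
    obtain ⟨t, ht⟩ := mem_range_code_of_termVal h.2.1
    have hm : m = 2 * Nat.pair s.code t.code + m % 2 := by
      rw [hs, ht, Nat.pair_unpair]
      omega
    have hlt := Nat.mod_lt m two_pos
    rw [hm] at h
    have := (key s t _ hlt).1 h
    refine ⟨s, t, ?_⟩
    obtain h2 | h2 := Nat.mod_two_eq_zero_or_one m
    · exact Or.inl ⟨this.2 h2, by omega⟩
    · exact Or.inr ⟨fun h => absurd (this.1 h) (by omega), by omega⟩
  · rintro ⟨s, t, ⟨h, rfl⟩ | ⟨h, rfl⟩⟩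
    · exact (key s t 0 two_pos).2 (by simpa using h)
    · exact (key s t 1 one_lt_two).2 (by simpa using h)

end

theorem computablePred_triples :
  ComputablePred fun y : ((ℕ × ℕ × ℕ) × (ℕ × ℕ × ℕ)) × ℕ => y.1.1.2.2 ≠ 0 ∧
    y.1.2.2.2 ≠ 0 ∧ (y.1.1.1 * y.1.2.2.2 + y.1.2.2.1 * y.1.1.2.2 =
      y.1.2.1 * y.1.1.2.2 + y.1.1.2.1 * y.1.2.2.2 ↔ y.2 % 2 = 0) := by
  simp only [iff_iff_and_or_not_and_not]
  have h4 : ComputablePred fun y : ((ℕ × ℕ × ℕ) × (ℕ × ℕ × ℕ)) × ℕ =>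
      y.1.1.1 * y.1.2.2.2 + y.1.2.2.1 * y.1.1.2.2 =
      y.1.2.1 * y.1.1.2.2 + y.1.1.2.1 * y.1.2.2.2 :=
    computablePred_eq (by fun_prop) (by fun_prop)
  have h5 : ComputablePred fun y : ((ℕ × ℕ × ℕ) × (ℕ × ℕ × ℕ)) × ℕ => y.2 % 2 = 0 :=
    computablePred_eq (by fun_prop) (by fun_prop)
  refine computablePred_and (computablePred_eq (by fun_prop) (by fun_prop)).not <|
    computablePred_and (computablePred_eq (by fun_prop) (by fun_prop)).not <|
    computablePred_or (computablePred_and h4 h5) (computablePred_and h4.not h5.not)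

theorem computablePred_fracTrue {α : Type*} [Primcodable α] {N : α → ℕ → ℕ}
    (hc : Computable fun x : α × ℕ => N x.1 x.2) :
    ComputablePred fun x : α × ℕ => fracTrue (N x.1) x.2 := by
  have hsame : ComputablePred fun x : (α × ℕ) × ℕ => SameFrac (N x.1.1) x.2 x.1.2 := by
    unfold SameFrac
    exact computablePred_eq (by fun_prop) (by fun_prop)
  have hU : ComputablePred fun x : α × ℕ => x.2 ∈ fracUniverse (N x.1) :=
    computablePred_forall_lt (p := fun (x : α × ℕ) c' => ¬ SameFrac (N x.1) c' x.2)
      (by fun_prop) hsame.not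
  have hb : Computable fun x : α × ℕ => fracBase (N x.1) x.2 := by
    classical
    have hite : Computable fun x : α × ℕ =>
        if x.2 ∈ fracUniverse (N x.1) then N x.1 x.2.unpair.2.unpair.2 else 0 :=
      computable_ite hU (by fun_prop) (by fun_prop)
    have : Computable fun x : α × ℕ => (x.2.unpair.1, x.2.unpair.2.unpair.1,
        if x.2 ∈ fracUniverse (N x.1) then N x.1 x.2.unpair.2.unpair.2 else 0) :=
      computable_pair (by fun_prop) (computable_pair (by fun_prop) hite)
    refine this.of_eq fun x => ?_
    rw [fracBase]
  have ht : Computable fun x : α × ℕ => termVal (fracBase (N x.1)) x.2 :=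
    computable_termVal (base := fun a => fracBase (N a)) hb
  have h1 : Computable fun x : α × ℕ => termVal (fracBase (N x.1)) (x.2 / 2).unpair.1 :=
    ht.comp (g := fun x : α × ℕ => (x.1, (x.2 / 2).unpair.1)) (by fun_prop)
  have h2 : Computable fun x : α × ℕ => termVal (fracBase (N x.1)) (x.2 / 2).unpair.2 :=
    ht.comp (g := fun x : α × ℕ => (x.1, (x.2 / 2).unpair.2)) (by fun_prop)
  exact computablePred_comp computablePred_triples
    (computable_pair (computable_pair h1 h2) Computable.snd)

/-- The index of the functions `m ↦ g n m`, for a computable `g`, as a computable function. -/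
theorem exists_computable_phi_eq {g : ℕ → ℕ →. ℕ} (hg : Partrec₂ g) :
    ∃ F : ℕ → ℕ, Computable F ∧ Function.Injective F ∧ ∀ n m, phi (F n) m = g n m := by
  obtain ⟨c, hc⟩ := Nat.Partrec.Code.exists_code.1 (Partrec₂.unpaired'.2 hg)
  refine ⟨fun n => Encodable.encode (c.curry n), ?_, fun n n' h => ?_, fun n m => ?_⟩
  · exact Computable.encode.comp
      (Nat.Partrec.Code.primrec₂_curry.to_comp.comp (Computable.const c) Computable.id)
  · exact (Nat.Partrec.Code.curry_inj (Encodable.encode_injective h)).2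
  · rw [phi, Denumerable.ofNat_encode, Nat.Partrec.Code.eval_curry, hc]
    simp

/-- A uniformly computable family of groups of fractions is uniformly computably presented. -/
theorem exists_computable_mem_indexSet {N : ℕ → ℕ → ℕ}
    (hc : Computable fun x : ℕ × ℕ => N x.1 x.2) (h0 : ∀ n s, 0 < N n s)
    (hN : ∀ n s t, s ≤ t → N n s ∣ N n t) :
    ∃ F : ℕ → ℕ, Computable F ∧
      ∀ n, F n ∈ indexSet (Multiplicative (fracGroup (N n) (hN n))) := by
  classical
  have hg : Computable fun x : ℕ × ℕ => if fracTrue (N x.1) x.2 then 1 else 0 :=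
    computable_ite (computablePred_fracTrue hc) (Computable.const 1) (Computable.const 0)
  obtain ⟨F, hF, -, h⟩ := exists_computable_phi_eq
    (g := fun n m => Part.some (if fracTrue (N n) m then 1 else 0)) hg.partrec
  refine ⟨F, hF, fun n => mem_indexSet_iff.2 ⟨fracUniverse (N n), fun c => fracVal (N n) c,
    fracVal_injective (h0 n), range_fracVal (h0 n) (hN n), fun m => ?_⟩⟩
  rw [h, ← fracTrue_iff (h0 n)]
  constructor
  · intro h
    rw [if_pos h]
    exact Part.mem_some 1
  · intro h
    rw [if_neg h]
    exact Part.mem_some 0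

/-! ### Computability of the sequence of primes and enumerability of the halting set -/

theorem computablePred_prime : ComputablePred Nat.Prime := by
  have h1 : ComputablePred fun x : ℕ × ℕ => x.2 = 1 := computablePred_eq (by fun_prop) (by fun_prop)
  have h2 : ComputablePred fun x : ℕ × ℕ => x.1 % x.2 = 0 :=
    computablePred_eq (by fun_prop) (by fun_prop)
  have h3 := computablePred_forall_lt (α := ℕ) (f := fun p => p)
    (p := fun p m => ¬ p % m = 0 ∨ m = 1) (by fun_prop) (computablePred_or h2.not h1)
  refine (computablePred_and (computablePred_le (Computable.const 2) Computable.id) h3).of_eq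
    fun p => ?_
  rw [Nat.prime_def_lt]
  simp only [← Nat.dvd_iff_mod_eq_zero, imp_iff_not_or, id]

/-- The `n`-th prime is found by searching for the prime with exactly `n` primes below it. -/
theorem computable_nth_prime : Computable (Nat.nth Nat.Prime) := by
  have hcount : Computable fun n => Nat.count Nat.Prime n :=
    (computable_rec (α := ℕ) Computable.id (Computable.const 0)
      (h := fun _ i r => if i.Prime then r + 1 else r)
      (computable_ite (computablePred_comp computablePred_prime (by fun_prop))
        (by fun_prop) (by fun_prop))).of_eq fun n => by
      induction n with
      | zero => rfl
      | succ n ih =>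
        rw [Nat.count_succ, ← ih]
        change (if n.Prime then _ else _) = _
        split_ifs <;> rfl
  have hex : ∀ n, ∃ p, p.Prime ∧ Nat.count Nat.Prime p = n := fun n =>
    ⟨Nat.nth Nat.Prime n, Nat.prime_nth_prime n,
      Nat.count_nth_of_infinite Nat.infinite_setOfPred_prime n⟩
  have hp : ComputablePred fun x : ℕ × ℕ => x.2.Prime ∧ Nat.count Nat.Prime x.2 = x.1 :=
    computablePred_and (computablePred_comp computablePred_prime (by fun_prop))
      (computablePred_eq (hcount.comp Computable.snd) (by fun_prop))
  refine (Computable.find (P := fun n p => p.Prime ∧ Nat.count Nat.Prime p = n) hp hex).of_eq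
    fun n => ?_
  obtain ⟨h1, h2⟩ := Nat.find_spec (hex n)
  conv_rhs => rw [← h2]
  exact (Nat.nth_count h1).symm

theorem rePred_haltingSet : REPred fun n => n ∈ haltingSet :=
  Partrec.dom_re (f := fun n => phi n n)
    (Nat.Partrec.Code.eval_part.comp (Computable.ofNat _) Computable.id)

/-- Every r.e. predicate is, through an injective computable function, the halting predicate. -/
theorem exists_computable_mem_haltingSet {p : ℕ → Prop} (hp : REPred p) :
    ∃ F : ℕ → ℕ, Computable F ∧ Function.Injective F ∧ ∀ n, F n ∈ haltingSet ↔ p n := by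
  -- The second argument is ignored, so the function with index `F n` halts on its own index exactly
  -- when `p n` holds.
  have hg : Partrec₂ fun n (_ : ℕ) => (Part.assert (p n) fun _ => Part.some ()).map fun _ => 0 :=
    Partrec.map (Partrec.comp hp Computable.fst) (Computable.const 0).to₂
  obtain ⟨F, hF, hinj, h⟩ := exists_computable_phi_eq hg
  refine ⟨F, hF, hinj, fun n => ?_⟩
  change (phi (F n) (F n)).Dom ↔ p n
  rw [h]
  simp [Part.assert]

/-! ### Divisibility chains -/

theorem prod_range_dvd_prod_range {g : ℕ → ℕ → ℕ} (hg : ∀ i s t, s ≤ t → g i s ∣ g i t) {s t : ℕ}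
    (h : s ≤ t) : ∏ i ∈ Finset.range s, g i s ∣ ∏ i ∈ Finset.range t, g i t :=
  (Finset.prod_dvd_prod_of_dvd _ _ fun i _ => hg i s t h).trans
    (Finset.prod_dvd_prod_of_subset _ _ _ (Finset.range_subset_range.2 h))

open Classical in
/-- The product of the `s`-th powers of the primes whose index has entered `K` by stage `s`. -/
noncomputable def infDen (K : ℕ → ℕ → Prop) (s : ℕ) : ℕ :=
  ∏ k ∈ Finset.range s, if K k s then Nat.nth Nat.Prime k ^ s else 1

open Classical in
/-- The product of the numbers `P i` whose index has entered `Q` by stage `s`. -/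
noncomputable def finDen (P : ℕ → ℕ) (Q : ℕ → ℕ → Prop) (s : ℕ) : ℕ :=
  ∏ i ∈ Finset.range s, if Q i s then P i else 1

section Chains

variable {K Q : ℕ → ℕ → Prop} {P : ℕ → ℕ}

theorem infDen_pos (s : ℕ) : 0 < infDen K s := by
  refine Finset.prod_pos fun k _ => ?_
  split_ifs
  · exact pow_pos (Nat.prime_nth_prime k).pos _
  · exact one_pos

theorem finDen_pos (hP : ∀ i, (P i).Prime) (s : ℕ) : 0 < finDen P Q s := by
  refine Finset.prod_pos fun k _ => ?_
  split_ifs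
  · exact (hP k).pos
  · exact one_pos

theorem infDen_dvd (hK : ∀ k s t, s ≤ t → K k s → K k t) (s t : ℕ) (h : s ≤ t) :
    infDen K s ∣ infDen K t := by
  classical
  refine prod_range_dvd_prod_range (g := fun k s => if K k s then _ else 1) (fun k s t h => ?_) h
  by_cases hs : K k s
  · rw [if_pos hs, if_pos (hK k s t h hs)]
    exact pow_dvd_pow _ h
  · rw [if_neg hs]
    exact one_dvd _

theorem finDen_dvd (hQ : ∀ i s t, s ≤ t → Q i s → Q i t) (s t : ℕ) (h : s ≤ t) :
    finDen P Q s ∣ finDen P Q t := by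
  classical
  refine prod_range_dvd_prod_range (g := fun k s => if Q k s then _ else 1) (fun k s t h => ?_) h
  by_cases hs : Q k s
  · rw [if_pos hs, if_pos (hQ k s t h hs)]
  · rw [if_neg hs]
    exact one_dvd _

/-- Exponents grow with the stage, so a later stage at which `k` has entered offers a spare factor
`p_k`. This is the infinite divisibility by primes indexed in `K`. -/
theorem exists_mul_infDen_dvd (hK : ∀ k s t, s ≤ t → K k s → K k t) {k : ℕ} (hk : ∃ s, K k s)
    (s : ℕ) : ∃ t, Nat.nth Nat.Prime k * infDen K s ∣ infDen K t := by
  obtain ⟨u, hu⟩ := hk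
  classical
  let t := s + k + u + 1
  refine ⟨t, ?_⟩
  have h1 : infDen K s ∣
      ∏ i ∈ Finset.range t, if K i s then Nat.nth Nat.Prime i ^ s else 1 :=
    Finset.prod_dvd_prod_of_subset _ _ _ (Finset.range_subset_range.2 (by omega))
  -- Writing `p_k` as a product over the same range reduces the divisibility to single factors.
  have h2 : Nat.nth Nat.Prime k =
      ∏ i ∈ Finset.range t, if k = i then Nat.nth Nat.Prime i else 1 := by
    rw [Finset.prod_ite_eq, if_pos (Finset.mem_range.2 (by omega))]
  refine (mul_dvd_mul_left _ h1).trans ?_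
  nth_rw 1 [h2]
  rw [← Finset.prod_mul_distrib]
  refine Finset.prod_dvd_prod_of_dvd _ _ fun i _ => ?_
  by_cases hs : K i s
  · rw [if_pos hs, if_pos (hK i s t (by omega) hs)]
    split_ifs
    · rw [← pow_succ']
      exact pow_dvd_pow _ (by omega)
    · rw [one_mul]
      exact pow_dvd_pow _ (by omega)
  · rw [if_neg hs, mul_one]
    split_ifs with h h' h'
    · exact dvd_pow_self _ (by omega)
    · exact absurd (hK k u t (by omega) hu) (h ▸ h')
    · exact one_dvd _
    · exact one_dvd _

theorem exists_dvd_infDen (hK : ∀ k s t, s ≤ t → K k s → K k t) {m : ℕ} (hm : m ≠ 0)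
    (h : ∀ p, p.Prime → p ∣ m → ∃ k, (∃ s, K k s) ∧ p = Nat.nth Nat.Prime k) :
    ∃ s, m ∣ infDen K s := by
  induction m using induction_on_primes with
  | zero => exact absurd rfl hm
  | one => exact ⟨0, one_dvd _⟩
  | prime_mul p a hp ih =>
    obtain ⟨s, hs⟩ := ih (right_ne_zero_of_mul hm) fun q hq hqa => h q hq (hqa.mul_left p)
    obtain ⟨k, hk, rfl⟩ := h p hp (dvd_mul_right _ _)
    obtain ⟨t, ht⟩ := exists_mul_infDen_dvd hK hk s
    exact ⟨t, (mul_dvd_mul_left _ hs).trans ht⟩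

theorem dvd_finDen (hQ : ∀ i s t, s ≤ t → Q i s → Q i t) {A : Finset ℕ}
    (hA : ∀ i ∈ A, ∃ s, Q i s) (s : ℕ) : ∃ t, s ≤ t ∧ ∏ i ∈ A, P i ∣ finDen P Q t := by
  choose! u hu using hA
  -- Beyond every index in `A` and every entry stage `u i`.
  let t := s + ∑ i ∈ A, (i + u i + 1)
  have ht : ∀ i ∈ A, i + u i + 1 ≤ t := fun i hi =>
    (Finset.single_le_sum (f := fun i => i + u i + 1) (fun _ _ => Nat.zero_le _) hi).trans
      (Nat.le_add_left _ _)
  refine ⟨t, Nat.le_add_right _ _, ?_⟩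
  classical
  have h : ∏ i ∈ A, P i = ∏ i ∈ A, if Q i t then P i else 1 :=
    Finset.prod_congr rfl fun i hi => by
      have := ht i hi
      rw [if_pos (hQ i (u i) t (by omega) (hu i hi))]
  rw [h]
  refine Finset.prod_dvd_prod_of_subset _ _ _ fun i hi => Finset.mem_range.2 ?_
  have := ht i hi
  omega

end Chains

/-! ### Subgroups of `ℚ` -/

section Subgroups

variable {G H : AddSubgroup ℚ}

theorem dividesOne_iff {m : ℕ} (hm : m ≠ 0) : DividesOne G m ↔ (m : ℚ)⁻¹ ∈ G := by
  have hm' : (m : ℚ) ≠ 0 := Nat.cast_ne_zero.2 hm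
  constructor
  · rintro ⟨g, hg, h⟩
    rw [nsmul_eq_mul] at h
    rwa [← eq_inv_of_mul_eq_one_right h]
  · exact fun h => ⟨_, h, by rw [nsmul_eq_mul, mul_inv_cancel₀ hm']⟩

theorem inv_mem_of_coprime (h1 : (1 : ℚ) ∈ G) {u : ℤ} {m : ℕ} (hm : m ≠ 0) (h : IsCoprime u m)
    (hu : (u : ℚ) / m ∈ G) : (m : ℚ)⁻¹ ∈ G := by
  obtain ⟨a, b, hab⟩ := h
  have hm' : (m : ℚ) ≠ 0 := Nat.cast_ne_zero.2 hm
  have : (m : ℚ)⁻¹ = a • ((u : ℚ) / m) + b • (1 : ℚ) := by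
    rw [zsmul_eq_mul, zsmul_eq_mul, mul_one]
    have hab' : (a : ℚ) * u + b * m = 1 := by exact_mod_cast hab
    field_simp
    linarith
  rw [this]
  exact add_mem (zsmul_mem hu _) (zsmul_mem h1 _)

theorem inv_mem_of_dvd {m n : ℕ} (hn : n ≠ 0) (h : m ∣ n) (hmem : (n : ℚ)⁻¹ ∈ G) :
    (m : ℚ)⁻¹ ∈ G := by
  obtain ⟨c, rfl⟩ := h
  have hc : (c : ℚ) ≠ 0 := Nat.cast_ne_zero.2 (right_ne_zero_of_mul hn)
  have := nsmul_mem hmem c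
  rwa [nsmul_eq_mul, Nat.cast_mul, mul_inv, mul_left_comm, mul_inv_cancel₀ hc, mul_one] at this

theorem inv_mul_mem_of_coprime {m n : ℕ} (hm : m ≠ 0) (hn : n ≠ 0) (h : m.Coprime n)
    (hmG : (m : ℚ)⁻¹ ∈ G) (hnG : (n : ℚ)⁻¹ ∈ G) : ((m * n : ℕ) : ℚ)⁻¹ ∈ G := by
  obtain ⟨a, b, hab⟩ := Nat.isCoprime_iff_coprime.2 h
  have hm' : (m : ℚ) ≠ 0 := Nat.cast_ne_zero.2 hm
  have hn' : (n : ℚ) ≠ 0 := Nat.cast_ne_zero.2 hn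
  have : ((m * n : ℕ) : ℚ)⁻¹ = a • (n : ℚ)⁻¹ + b • (m : ℚ)⁻¹ := by
    rw [zsmul_eq_mul, zsmul_eq_mul, Nat.cast_mul]
    have hab' : (a : ℚ) * m + b * n = 1 := by exact_mod_cast hab
    field_simp
    linarith
  rw [this]
  exact add_mem (zsmul_mem hnG _) (zsmul_mem hmG _)

/-- Since `PFin G` is empty, a single division of 1 by `p` forces divisibility by all powers of `p`.
-/
theorem exists_eq_nth_of_inv_mem (hInf : PInf G = {p | ∃ n ∈ haltingSet, p = Nat.nth Nat.Prime n})
    (hFin : PFin G = ∅) {p : ℕ} (hp : p.Prime) (h : (p : ℚ)⁻¹ ∈ G) :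
    ∃ n ∈ haltingSet, p = Nat.nth Nat.Prime n := by
  have hmem : p ∈ PInf G := by
    refine ⟨hp, fun k => ?_⟩
    by_contra hk
    have : p ∈ PFin G := ⟨hp, (dividesOne_iff hp.ne_zero).2 h, k, hk⟩
    rw [hFin] at this
    exact this
  rwa [hInf] at hmem

/-- A subgroup of `ℚ` without finite divisibility at any prime is a group of fractions. -/
theorem eq_fracGroup_infDen (h1 : (1 : ℚ) ∈ G)
    (hInf : PInf G = {p | ∃ n ∈ haltingSet, p = Nat.nth Nat.Prime n}) (hFin : PFin G = ∅)
    {K : ℕ → ℕ → Prop} (hK : ∀ k s t, s ≤ t → K k s → K k t)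
    (hK' : ∀ k, k ∈ haltingSet ↔ ∃ s, K k s) :
    G = fracGroup (infDen K) (infDen_dvd hK) := by
  ext q
  rw [mem_fracGroup]
  constructor
  · intro hq
    have hden : ((q.den : ℕ) : ℚ)⁻¹ ∈ G := by
      refine inv_mem_of_coprime h1 q.den_nz (Int.isCoprime_iff_nat_coprime.2 q.reduced) ?_
      rwa [Rat.num_div_den]
    obtain ⟨s, c, hs⟩ := exists_dvd_infDen hK q.den_nz fun p hp hpd => by
      obtain ⟨k, hk, h⟩ := exists_eq_nth_of_inv_mem hInf hFin hp
        (inv_mem_of_dvd q.den_nz hpd hden)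
      exact ⟨k, (hK' k).1 hk, h⟩
    refine ⟨s, q.num * c, ?_⟩
    rw [hs]
    push_cast
    rw [← mul_assoc, Rat.mul_den_eq_num]
  · rintro ⟨s, z, h⟩
    have hN : ((infDen K s : ℕ) : ℚ)⁻¹ ∈ G := by
      classical
      -- The prime powers are pairwise coprime, so their inverses combine one at a time; the stage
      -- `s` stays fixed while the range grows.
      suffices ∀ m, ((∏ k ∈ Finset.range m,
          if K k s then Nat.nth Nat.Prime k ^ s else 1 : ℕ) : ℚ)⁻¹ ∈ G by
        rw [infDen]
        exact this s
      intro m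
      induction m with
      | zero => simpa using h1
      | succ m ih =>
        rw [Finset.prod_range_succ]
        by_cases hm : K m s
        · rw [if_pos hm]
          have hp : Nat.nth Nat.Prime m ∈ PInf G := by
            rw [hInf]
            exact ⟨m, (hK' m).2 ⟨s, hm⟩, rfl⟩
          have hpow : Nat.nth Nat.Prime m ^ s ≠ 0 := (pow_pos (Nat.prime_nth_prime m).pos _).ne'
          refine inv_mul_mem_of_coprime ?_ hpow ?_ ih ((dividesOne_iff hpow).1 (hp.2 s))
          · refine Finset.prod_ne_zero_iff.2 fun k _ => ?_
            split_ifs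
            · exact (pow_pos (Nat.prime_nth_prime k).pos _).ne'
            · exact one_ne_zero
          · refine Nat.Coprime.prod_left fun k hk => ?_
            split_ifs
            · refine Nat.Coprime.pow _ _ ((Nat.coprime_primes (Nat.prime_nth_prime k)
                (Nat.prime_nth_prime m)).2 fun h => ?_)
              have := Nat.nth_injective Nat.infinite_setOfPred_prime h
              have := Finset.mem_range.1 hk
              omega
            · exact Nat.coprime_one_left _
        · rwa [if_neg hm, mul_one]
    have hne : (infDen K s : ℚ) ≠ 0 := Nat.cast_ne_zero.2 (infDen_pos s).ne'
    have := zsmul_mem hN z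
    rwa [zsmul_eq_mul, ← h, mul_assoc, mul_inv_cancel₀ hne, mul_one] at this

theorem nonempty_addEquiv_of_mul_mem {r : ℚ} (hr : r ≠ 0) (h : ∀ x, x ∈ H ↔ r * x ∈ G) :
    Nonempty (H ≃+ G) :=
  ⟨{ toFun := fun x => ⟨r * x, (h x).1 x.2⟩
     invFun := fun y => ⟨r⁻¹ * y, (h _).2 (by rw [mul_inv_cancel_left₀ hr]; exact y.2)⟩
     left_inv := fun x => Subtype.ext (inv_mul_cancel_left₀ hr _)
     right_inv := fun y => Subtype.ext (mul_inv_cancel_left₀ hr _)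
     map_add' := fun x y => Subtype.ext (mul_add _ _ _) }⟩

/-- Apply `θ` to `den x • x = num x • 1` and cancel the denominator. -/
theorem coe_addEquiv_eq_mul (h1 : (1 : ℚ) ∈ G) (θ : G ≃+ H) (x : G) :
    (θ x : ℚ) = x * (θ ⟨1, h1⟩ : ℚ) := by
  have h : (x : ℚ).den • x = (x : ℚ).num • (⟨1, h1⟩ : G) := by
    apply Subtype.ext
    simp [Rat.den_mul_eq_num]
  have h' := congrArg (fun y => ((θ y : H) : ℚ)) h
  simp only [map_nsmul, map_zsmul, AddSubgroup.coe_nsmul, AddSubgroup.coe_zsmul, nsmul_eq_mul,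
    zsmul_eq_mul] at h'
  have hd : ((x : ℚ).den : ℚ) ≠ 0 := Nat.cast_ne_zero.2 (x : ℚ).den_nz
  apply mul_left_cancel₀ hd
  rw [h', ← mul_assoc, Rat.den_mul_eq_num]

/-- Isomorphic subgroups of `ℚ` containing `1` differ in divisibility by only finitely many
primes. -/
theorem finite_of_addEquiv (h1 : (1 : ℚ) ∈ G) (θ : G ≃+ H) {P : ℕ → ℕ} (hP : ∀ i, (P i).Prime)
    (hinj : Function.Injective P) :
    {i | (P i : ℚ)⁻¹ ∈ H ∧ (P i : ℚ)⁻¹ ∉ G}.Finite := by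
  let r : ℚ := θ ⟨1, h1⟩
  have hr : r ≠ 0 := by
    intro h
    have h2 : θ ⟨1, h1⟩ = 0 := Subtype.ext h
    have h3 : (⟨1, h1⟩ : G) = 0 := by simpa only [map_eq_zero_iff θ θ.injective] using h2
    exact one_ne_zero (congrArg Subtype.val h3)
  -- `θ` is multiplication by `r`. If `1/p = y * r` with `y ∈ G`, then `den r / p = num r • y` lies
  -- in `G`; were `p` prime to `den r`, Bézout would put `1/p` in `G`. So the exceptional primes
  -- divide `den r`.
  refine Set.Finite.subset ((Nat.divisors r.den).finite_toSet.preimage hinj.injOn) ?_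
  rintro i ⟨hiH, hiG⟩
  simp only [Set.mem_preimage, Finset.mem_coe, Nat.mem_divisors]
  refine ⟨?_, r.den_nz⟩
  by_contra hdvd
  apply hiG
  have hy := coe_addEquiv_eq_mul h1 θ (θ.symm ⟨_, hiH⟩)
  rw [AddEquiv.apply_symm_apply] at hy
  set y := θ.symm ⟨_, hiH⟩
  have hy' : (P i : ℚ)⁻¹ = y * r := hy
  refine inv_mem_of_coprime h1 (hP i).ne_zero (u := r.den)
    (Nat.isCoprime_iff_coprime.2 (((hP i).coprime_iff_not_dvd.2 hdvd).symm)) ?_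
  have : ((r.den : ℤ) : ℚ) / P i = r.num • (y : ℚ) := by
    rw [div_eq_mul_inv, hy', zsmul_eq_mul, ← Rat.den_mul_eq_num]
    push_cast
    ring
  rw [this]
  exact zsmul_mem y.2 _

/-- The isomorphism is multiplication by the product `D` of the finitely many new primes. It cancels
them from denominators, and the remaining adjoined primes have index in `K`, so dividing by them
does not leave the smaller group. -/
theorem nonempty_addEquiv_of_finite {K Q : ℕ → ℕ → Prop} (hK : ∀ k s t, s ≤ t → K k s → K k t)
    (hQ : ∀ i s t, s ≤ t → Q i s → Q i t) {h : ℕ → ℕ}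
    (hfin : {i | (∃ s, Q i s) ∧ ¬ ∃ s, K (h i) s}.Finite)
    (hd : ∀ s t, s ≤ t → infDen K s * finDen (fun i => Nat.nth Nat.Prime (h i)) Q s ∣
      infDen K t * finDen (fun i => Nat.nth Nat.Prime (h i)) Q t) :
    Nonempty (fracGroup (fun s => infDen K s * finDen (fun i => Nat.nth Nat.Prime (h i)) Q s) hd ≃+
      fracGroup (infDen K) (infDen_dvd hK)) := by
  classical
  set P : ℕ → ℕ := fun i => Nat.nth Nat.Prime (h i)
  have hP : ∀ i, (P i).Prime := fun i => Nat.prime_nth_prime _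
  set D : ℕ := ∏ i ∈ hfin.toFinset, P i with hD
  have hD0 : (D : ℚ) ≠ 0 := Nat.cast_ne_zero.2 (Finset.prod_ne_zero_iff.2 fun i _ => (hP i).ne_zero)
  have hdiv : ∀ k, (∃ s, K k s) → ∀ x ∈ fracGroup (infDen K) (infDen_dvd hK),
      x / Nat.nth Nat.Prime k ∈ fracGroup (infDen K) (infDen_dvd hK) := by
    rintro k hk x ⟨s, z, hx⟩
    obtain ⟨t, c, ht⟩ := exists_mul_infDen_dvd hK hk s
    have hne : (Nat.nth Nat.Prime k : ℚ) ≠ 0 := Nat.cast_ne_zero.2 (Nat.prime_nth_prime k).ne_zero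
    refine ⟨t, z * c, ?_⟩
    rw [ht]
    push_cast
    rw [← hx]
    field_simp
  refine nonempty_addEquiv_of_mul_mem hD0 fun x => ⟨?_, ?_⟩
  · rintro ⟨s, z, hx⟩
    have hne : (infDen K s : ℚ) ≠ 0 := Nat.cast_ne_zero.2 (infDen_pos s).ne'
    -- The factors of `finDen` are split by whether their index ever enters `K`; those that never do
    -- are among the factors of `D`.
    have hdvd : finDen P Q s ∣ D * ∏ i ∈ Finset.range s,
        if Q i s ∧ ∃ s, K (h i) s then P i else 1 := by
      have h1 : finDen P Q s = (∏ i ∈ Finset.range s,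
          if Q i s ∧ ¬ ∃ s, K (h i) s then P i else 1) * ∏ i ∈ Finset.range s,
          if Q i s ∧ ∃ s, K (h i) s then P i else 1 := by
        rw [← Finset.prod_mul_distrib, finDen]
        refine Finset.prod_congr rfl fun i _ => ?_
        by_cases h2 : Q i s <;> by_cases h3 : ∃ s, K (h i) s <;> simp [h2, h3]
      rw [h1]
      refine mul_dvd_mul_right ?_ _
      rw [← Finset.prod_filter]
      refine Finset.prod_dvd_prod_of_subset _ _ _ fun i hi => ?_
      rw [Finset.mem_filter] at hi
      exact hfin.mem_toFinset.2 ⟨⟨s, hi.2.1⟩, hi.2.2⟩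
    have hquot : ∀ m, ∀ y ∈ fracGroup (infDen K) (infDen_dvd hK),
        y / ((∏ i ∈ Finset.range m, if Q i s ∧ ∃ s, K (h i) s then P i else 1 : ℕ) : ℚ) ∈
          fracGroup (infDen K) (infDen_dvd hK) := by
      intro m y hy
      induction m with
      | zero => simpa using hy
      | succ m ih =>
        rw [Finset.prod_range_succ]
        by_cases hm : Q m s ∧ ∃ s, K (h m) s
        · rw [if_pos hm, Nat.cast_mul, ← div_div]
          exact hdiv _ hm.2 _ ih
        · rwa [if_neg hm, mul_one]
    obtain ⟨c, hc⟩ := hdvd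
    have hE : ((∏ i ∈ Finset.range s, if Q i s ∧ ∃ s, K (h i) s then P i else 1 : ℕ) : ℚ) ≠ 0 := by
      refine Nat.cast_ne_zero.2 (Finset.prod_ne_zero_iff.2 fun i _ => ?_)
      split_ifs
      · exact (hP i).ne_zero
      · exact one_ne_zero
    have hmem := hquot s (((z * c : ℤ) : ℚ) / infDen K s) ⟨s, z * c, div_mul_cancel₀ _ hne⟩
    convert hmem using 1
    rw [div_div, eq_div_iff (mul_ne_zero hne hE)]
    have hc' : (D : ℚ) * ((∏ i ∈ Finset.range s,
        if Q i s ∧ ∃ s, K (h i) s then P i else 1 : ℕ) : ℚ) = finDen P Q s * c := by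
      exact_mod_cast hc
    rw [Nat.cast_mul] at hx
    rw [Int.cast_mul, ← hx, Int.cast_natCast]
    linear_combination x * (infDen K s : ℚ) * hc'
  · rintro ⟨s, z, hx⟩
    -- Conversely, at a late enough stage all of `D` appears in the denominator, so dividing by `D`
    -- stays in the larger group.
    obtain ⟨t, hst, c, hc⟩ := dvd_finDen (P := P) hQ (A := hfin.toFinset)
      (fun i hi => (hfin.mem_toFinset.1 hi).1) s
    obtain ⟨c', hc'⟩ := infDen_dvd hK s t hst
    refine ⟨t, z * (c * c'), ?_⟩
    change x * ((infDen K t * finDen P Q t : ℕ) : ℚ) = _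
    rw [hc, hc', ← hD]
    push_cast
    rw [← hx]
    ring

end Subgroups

/-! ### The lower bound -/

/-- The stage `s` approximation to the statement, for `i = ⟨x, j⟩`, that some `x' ≤ x` satisfies
`∃ z, R (n, x', y, z)` for all `y < j`. -/
def MarkerStage (R : ℕ × ℕ × ℕ × ℕ → Prop) (n i s : ℕ) : Prop :=
  ∃ x < i.unpair.1 + 1, ∀ y < i.unpair.2, ∃ z < s, R (n, x, y, z)

section Marker

variable {R : ℕ × ℕ × ℕ × ℕ → Prop} {n : ℕ}

theorem computablePred_markerStage {α : Type*} [Primcodable α] (hR : ComputablePred R)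
    {n i s : α → ℕ} (hn : Computable n) (hi : Computable i) (hs : Computable s) :
    ComputablePred fun a => MarkerStage R (n a) (i a) (s a) := by
  unfold MarkerStage
  refine computablePred_exists_lt (p := fun a x => ∀ y < (i a).unpair.2,
    ∃ z < s a, R (n a, x, y, z)) (by fun_prop) ?_
  refine computablePred_forall_lt (p := fun (a : α × ℕ) y =>
    ∃ z < s a.1, R (n a.1, a.2, y, z)) (by fun_prop) ?_
  refine computablePred_exists_lt (p := fun (a : (α × ℕ) × ℕ) z =>
    R (n a.1.1, a.1.2, a.2, z)) (by fun_prop) ?_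
  fun_prop

theorem MarkerStage.mono {i s t : ℕ} (hst : s ≤ t) (h : MarkerStage R n i s) :
    MarkerStage R n i t := by
  obtain ⟨x, hx, h⟩ := h
  refine ⟨x, hx, fun y hy => ?_⟩
  obtain ⟨z, hz, hR⟩ := h y hy
  exact ⟨z, hz.trans_le hst, hR⟩

theorem exists_markerStage_iff {x j : ℕ} : (∃ s, MarkerStage R n (Nat.pair x j) s) ↔
    ∃ x' ≤ x, ∀ y < j, ∃ z, R (n, x', y, z) := by
  simp only [MarkerStage, Nat.unpair_pair, Nat.lt_succ_iff]
  constructor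
  · rintro ⟨s, x', hx', h⟩
    exact ⟨x', hx', fun y hy => (h y hy).imp fun z hz => hz.2⟩
  · rintro ⟨x', hx', h⟩
    choose! z hz using h
    -- Only finitely many `y` are involved, so one stage bounds all their witnesses.
    refine ⟨∑ y ∈ Finset.range j, (z y + 1), x', hx', fun y hy => ⟨z y, ?_, hz y hy⟩⟩
    exact Finset.single_le_sum (f := fun y => z y + 1) (fun _ _ => Nat.zero_le _)
      (Finset.mem_range.2 hy)

/-- The final positions of the movable markers are finitely many iff some column is infinite. -/
theorem finite_marker_iff :
    {i | (∃ s, MarkerStage R n i s) ∧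
      ¬ ∃ s, MarkerStage R n (Nat.pair i.unpair.1 (i.unpair.2 + 1)) s}.Finite ↔
      ∃ x, ∀ y, ∃ z, R (n, x, y, z) := by
  constructor
  · intro hfin
    by_contra hno
    push Not at hno
    choose Y hY using hno
    -- Without an infinite column every marker stops, so the final positions project onto all of
    -- `ℕ`.
    refine Set.infinite_univ (α := ℕ) ((hfin.image fun i => i.unpair.1).subset fun x _ => ?_)
    have hex : ∃ j, ¬ ∃ s, MarkerStage R n (Nat.pair x j) s := by
      -- This bound exceeds the failure point `Y x'` of each of the columns `x' ≤ x`.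
      refine ⟨∑ x' ∈ Finset.range (x + 1), (Y x' + 1), fun h => ?_⟩
      obtain ⟨x', hx', h⟩ := exists_markerStage_iff.1 h
      obtain ⟨z, hz⟩ := h (Y x') (Finset.single_le_sum (f := fun x' => Y x' + 1)
        (fun _ _ => Nat.zero_le _) (Finset.mem_range.2 (Nat.lt_succ_of_le hx')))
      exact hY x' z hz
    classical
    -- Position 0 is reached vacuously, so the least unreached position has a predecessor, where the
    -- marker rests.
    have h0 : Nat.find hex ≠ 0 := by
      intro h0
      have := Nat.find_spec hex
      rw [h0] at this
      exact this (exists_markerStage_iff.2 ⟨x, le_rfl, fun y hy => absurd hy (Nat.not_lt_zero y)⟩)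
    obtain ⟨j, hj⟩ := Nat.exists_eq_succ_of_ne_zero h0
    refine ⟨Nat.pair x j, ⟨?_, ?_⟩, by simp⟩
    · by_contra h
      exact Nat.find_min hex (by omega : j < Nat.find hex) h
    · rw [Nat.unpair_pair]
      have := Nat.find_spec hex
      rwa [hj] at this
  · rintro ⟨x₀, hx₀⟩
    -- Markers `x ≥ x₀` never rest, because `x₀` is among the columns they consult, and each other
    -- marker has at most one final position.
    refine Set.Finite.of_finite_image (f := fun i => i.unpair.1)
      ((Set.finite_lt_nat x₀).subset ?_) ?_
    · rintro _ ⟨i, ⟨-, hi⟩, rfl⟩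
      by_contra hlt
      exact hi (exists_markerStage_iff.2 ⟨x₀, not_lt.1 hlt, fun y _ => hx₀ y⟩)
    · have key : ∀ x j j', (∃ s, MarkerStage R n (Nat.pair x j') s) →
          (¬ ∃ s, MarkerStage R n (Nat.pair x (j + 1)) s) → j' ≤ j := by
        intro x j j' h h'
        by_contra hlt
        obtain ⟨x', hx', h⟩ := exists_markerStage_iff.1 h
        exact h' (exists_markerStage_iff.2 ⟨x', hx', fun y hy => h y (by omega)⟩)
      rintro i ⟨hi, hi'⟩ i' ⟨hi2, hi2'⟩ heq
      dsimp only at heq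
      rw [← Nat.pair_unpair i] at hi
      rw [← Nat.pair_unpair i', ← heq] at hi2
      rw [← heq] at hi2'
      have := le_antisymm (key _ _ _ hi hi2') (key _ _ _ hi2 hi')
      rw [← Nat.pair_unpair i, ← Nat.pair_unpair i', heq, this]

end Marker

section Computability

variable {α : Type*} [Primcodable α]

theorem computable_infDen {K : ℕ → ℕ → Prop} (hK : ComputablePred fun x : ℕ × ℕ => K x.1 x.2) :
    Computable (infDen K) := by
  classical
  have hp := computable_nth_prime
  refine computable_prod (α := ℕ) (f := fun s => s)
    (g := fun s k => if K k s then Nat.nth Nat.Prime k ^ s else 1) (by fun_prop) ?_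
  exact computable_ite (computablePred_comp hK (g := fun x : ℕ × ℕ => (x.2, x.1)) (by fun_prop))
    (by fun_prop) (by fun_prop)

theorem computable_finDen {P : α → ℕ → ℕ} {Q : α → ℕ → ℕ → Prop}
    (hP : Computable fun x : α × ℕ => P x.1 x.2)
    (hQ : ComputablePred fun x : (α × ℕ) × ℕ => Q x.1.1 x.1.2 x.2) :
    Computable fun x : α × ℕ => finDen (P x.1) (Q x.1) x.2 := by
  classical
  refine computable_prod (f := fun x : α × ℕ => x.2)
    (g := fun x i => if Q x.1 i x.2 then P x.1 i else 1) (by fun_prop) ?_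
  exact computable_ite (computablePred_comp hQ
    (g := fun x : (α × ℕ) × ℕ => ((x.1.1, x.2), x.1.2)) (by fun_prop))
    (by fun_prop) (by fun_prop)

end Computability

theorem manyOneReducible_indexSet {G : AddSubgroup ℚ} (h1 : (1 : ℚ) ∈ G)
    (hInf : PInf G = {p | ∃ n ∈ haltingSet, p = Nat.nth Nat.Prime n}) (hFin : PFin G = ∅)
    {T : Set ℕ} (hT : IsSigma3 T) :
    ManyOneReducible (fun n => n ∈ T) (fun n => n ∈ indexSet (Multiplicative G)) := by
  obtain ⟨R, hR, hRT⟩ := hT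
  obtain ⟨K, hKc, hK, hK'⟩ := rePred_iff.1 rePred_haltingSet
  have hM : ComputablePred fun x : (ℕ × ℕ) × ℕ => MarkerStage R x.1.1 x.1.2 x.2 :=
    computablePred_markerStage hR (by fun_prop) (by fun_prop) (by fun_prop)
  -- For `t = ⟨n, ⟨x, j⟩⟩` this says that the marker of `x` moves on to `j + 1`; `F` turns it into
  -- membership in `K`.
  have hre : REPred fun t : ℕ => ∃ s, MarkerStage R t.unpair.1
      (Nat.pair t.unpair.2.unpair.1 (t.unpair.2.unpair.2 + 1)) s := by
    refine rePred_exists_of_computablePred (α := ℕ) (q := fun t s => MarkerStage R t.unpair.1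
      (Nat.pair t.unpair.2.unpair.1 (t.unpair.2.unpair.2 + 1)) s) ?_
    exact computablePred_markerStage hR (by fun_prop) (by fun_prop) (by fun_prop)
  obtain ⟨F, hF, hFinj, hFK⟩ := exists_computable_mem_haltingSet hre
  have hQ : ∀ n i s t, s ≤ t → MarkerStage R n i s → MarkerStage R n i t :=
    fun n i s t hst h => h.mono hst
  have hd : ∀ n s t, s ≤ t →
      infDen K s * finDen (fun i => Nat.nth Nat.Prime (F (Nat.pair n i))) (MarkerStage R n) s ∣
      infDen K t * finDen (fun i => Nat.nth Nat.Prime (F (Nat.pair n i))) (MarkerStage R n) t :=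
    fun n s t hst => mul_dvd_mul (infDen_dvd hK s t hst) (finDen_dvd (hQ n) s t hst)
  have hprime : ∀ n i, (Nat.nth Nat.Prime (F (Nat.pair n i))).Prime :=
    fun n i => Nat.prime_nth_prime _
  have hPinj : ∀ n, Function.Injective fun i => Nat.nth Nat.Prime (F (Nat.pair n i)) :=
    fun n i i' h =>
      (Nat.pair_eq_pair.1 (hFinj (Nat.nth_injective Nat.infinite_setOfPred_prime h))).2
  have hNc : Computable fun x : ℕ × ℕ => infDen K x.2 *
      finDen (fun i => Nat.nth Nat.Prime (F (Nat.pair x.1 i))) (MarkerStage R x.1) x.2 := by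
    have hp := computable_nth_prime
    exact computable_mul ((computable_infDen hKc).comp Computable.snd)
      (computable_finDen (P := fun n i => Nat.nth Nat.Prime (F (Nat.pair n i)))
        (Q := MarkerStage R) (by fun_prop) hM)
  obtain ⟨E, hE, hEmem⟩ := exists_computable_mem_indexSet (N := fun n s => infDen K s *
      finDen (fun i => Nat.nth Nat.Prime (F (Nat.pair n i))) (MarkerStage R n) s)
    hNc (fun n s => mul_pos (infDen_pos s) (finDen_pos (hprime n) s)) hd
  have hG := eq_fracGroup_infDen h1 hInf hFin hK hK'
  -- The genuinely new primes are those at final marker positions.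
  have hA : ∀ n, {i | (∃ s, MarkerStage R n i s) ∧ ¬ ∃ s, K (F (Nat.pair n i)) s} =
      {i | (∃ s, MarkerStage R n i s) ∧
        ¬ ∃ s, MarkerStage R n (Nat.pair i.unpair.1 (i.unpair.2 + 1)) s} := by
    intro n
    ext i
    have := hFK (Nat.pair n i)
    rw [hK', Nat.unpair_pair] at this
    exact and_congr_right fun _ => not_congr this
  refine ⟨E, hE, fun n => ?_⟩
  change n ∈ T ↔ E n ∈ indexSet (Multiplicative G)
  rw [hRT, ← finite_marker_iff, ← hA]
  constructor
  · intro hfin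
    obtain ⟨θ⟩ := nonempty_addEquiv_of_finite hK (hQ n) (h := fun i => F (Nat.pair n i)) hfin (hd n)
    rw [hG, ← indexSet_congr (AddEquiv.toMultiplicative θ)]
    exact hEmem n
  · intro hmem
    obtain ⟨θ⟩ := nonempty_addEquiv_of_mem_indexSet hmem (hEmem n)
    -- Injectivity of `F` keeps the primes at different positions distinct, so finitely many
    -- exceptional primes mean finitely many positions.
    refine (finite_of_addEquiv h1 θ (hprime n) (hPinj n)).subset ?_
    rintro i ⟨hi, hiK⟩
    refine ⟨?_, fun hiG => ?_⟩
    · obtain ⟨t, -, c, hc⟩ := dvd_finDen (P := fun i => Nat.nth Nat.Prime (F (Nat.pair n i)))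
        (hQ n) (A := {i}) (fun j hj => by rwa [Finset.mem_singleton.1 hj]) 0
      refine ⟨t, infDen K t * c, ?_⟩
      have hne : (Nat.nth Nat.Prime (F (Nat.pair n i)) : ℚ) ≠ 0 :=
        Nat.cast_ne_zero.2 (hprime n i).ne_zero
      rw [Finset.prod_singleton] at hc
      beta_reduce
      rw [hc]
      push_cast
      field_simp
    · obtain ⟨k, hk, h⟩ := exists_eq_nth_of_inv_mem hInf hFin (hprime n i) hiG
      rw [← Nat.nth_injective Nat.infinite_setOfPred_prime h] at hk
      exact hiK ((hK' _).1 hk)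

theorem isSigma3_indexSet {G : AddSubgroup ℚ} (h1 : (1 : ℚ) ∈ G)
    (hInf : PInf G = {p | ∃ n ∈ haltingSet, p = Nat.nth Nat.Prime n}) (hFin : PFin G = ∅) :
    IsSigma3 (indexSet (Multiplicative G)) := by
  obtain ⟨K, hKc, hK, hK'⟩ := rePred_iff.1 rePred_haltingSet
  rw [eq_fracGroup_infDen h1 hInf hFin hK hK']
  exact isSigma3_indexSet_fracGroup _ infDen_pos (computable_infDen hKc)

end IndexSets

theorem mainTheorem4 (G : AddSubgroup ℚ) (h1 : (1 : ℚ) ∈ G)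
    (hInf : IndexSets.PInf G = {p | ∃ n ∈ IndexSets.haltingSet, p = Nat.nth Nat.Prime n})
    (hFin : IndexSets.PFin G = ∅) :
    IndexSets.IsMComplete IndexSets.IsSigma3 (IndexSets.indexSet (Multiplicative G)) :=
  ⟨IndexSets.isSigma3_indexSet h1 hInf hFin,
    fun _ hT => IndexSets.manyOneReducible_indexSet h1 hInf hFin hT⟩
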